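/- Let $M$ be a complete, connected $\mathcal C^\infty$-Riemannian manifold (finite-dimensional, without boundary) with Levi-Civita connection $\nabla$ and curvature tensor $R(U,V)W=\nabla_U\nabla_VW-\nabla_V\nabla_UW-\nabla_{[U,V]}W$, and put $$\|R(x)\|=\sup_{u,v,w\in T_xM}\frac{\|R(x)(u,v)w\|}{\|u\|\,\|v\|\,\|w\|}.$$ For $g\in\mathcal C^2(M)$ and $V\in\mathfrak X^2(M)$ (the $\mathcal C^2$-vector fields on $M$) let $$\nabla^2g(U,W)=U(Wg)-(\nabla_UW)g,\qquad \nabla^2V(U,W)=\nabla_U\nabla_WV-\nabla_{\nabla_UW}V,$$ $$\|g\|_{\mathcal C^2_b(M)}=\sup_{x\in M}\bigl(|g(x)|\vee\|\mathrm{grad}\,g(x)\|\vee\|\nabla^2g(x)\|\bigr),\qquad \|V\|_{\mathfrak X^2_b(M)}=\sup_{x\in M}\bigl(\|V(x)\|\vee\|\nabla V(x)\|\vee\|\nabla^2V(x)\|\bigr),$$ where the norm of a multilinear map on $T_xM$ is the supremum of its norm over unit vectors. Let $\mathcal C^2_b(M)$ and $\mathfrak X^2_b(M)$ be the sets of those $g\in\mathcal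 C^2(M)$ and $V\in\mathfrak X^2(M)$, respectively, for which these norms are finite. Let $V\in\mathfrak X^2_b(M)$ and assume that $\sup_{x\in M}\|R(x)\|<\infty$. Then the equation $\dot x_t(x)=V(x_t(x))$, $x_0(x)=x$, has for every $x\in M$ a unique solution $(x_t(x))_{t\in\mathbb R}$ defined for all times. Moreover, for every $g\in\mathcal C^2_b(M)$ and every $T\ge0$ there exists a constant $C\ge0$ that only depends on $T$, $\|g\|_{\mathcal C^2_b(M)}$, $\|V\|_{\mathfrak X^2_b(M)}$ and $\sup_{x\in M}\|R(x)\|$ (in particular not otherwise on $M$ or on its dimension) such that for all $0\le t\le T$ the function $$\varphi_t:M\to\mathbb R,\qquad \varphi_t(x)=g(x_t(x)),$$ belongs to $\mathcal C^2_b(M)$ and satisfies $\|\varphi_t\|_{\mathcal C^2_b(M)}\le C$. -/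

import Mathlib

open Bundle Manifold VectorField FiberBundle
open scoped ContDiff ENNReal NNReal

set_option linter.unusedSectionVars false

noncomputable section

namespace RiemannianFlow

variable {E : Type*} [NormedAddCommGroup E] [NormedSpace ℝ E]
  {H : Type*} [TopologicalSpace H] {I : ModelWithCorners ℝ E H}
  {M : Type*} [TopologicalSpace M] [ChartedSpace H M] [IsManifold I ∞ M]
  [RiemannianBundle (fun x : M ↦ TangentSpace I x)]

/-! ### The Levi-Civita connection -/

/-- The right-hand side of the Koszul formula for `⟨∇_X Y, Z⟩` at the point `x`. -/
def koszul (Y X Z : Π x : M, TangentSpace I x) (x : M) : ℝ :=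
  (1 / 2) * (mvfderiv I (fun y ↦ inner ℝ (Y y) (Z y)) x (X x)
    + mvfderiv I (fun y ↦ inner ℝ (X y) (Z y)) x (Y x)
    - mvfderiv I (fun y ↦ inner ℝ (X y) (Y y)) x (Z x)
    + inner ℝ (mlieBracket I X Y x) (Z x)
    - inner ℝ (mlieBracket I X Z x) (Y x)
    - inner ℝ (mlieBracket I Y Z x) (X x))

variable [IsContMDiffRiemannianBundle I ∞ E (fun x : M ↦ TangentSpace I x)]

theorem mdifferentiableAt_inner {X Y : Π x : M, TangentSpace I x} {x : M}
    (hX : MDiffAt (T% X) x) (hY : MDiffAt (T% Y) x) :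
    MDiffAt (fun y ↦ inner ℝ (X y) (Y y)) x :=
  MDifferentiableAt.inner_bundle (IB := I) (F := E) (E := fun x : M ↦ TangentSpace I x)
    (b := fun y ↦ y) hX hY

variable [FiniteDimensional ℝ E] [CompleteSpace E]

theorem koszul_tensorial_left {Y Z : Π x : M, TangentSpace I x} {x : M}
    (hY : MDiffAt (T% Y) x) (hZ : MDiffAt (T% Z) x) :
    TensorialAt I E (fun X ↦ koszul Y X Z x) x where
  smul {f X} hf hX := by
    have h1 : (fun y ↦ inner ℝ ((f • X) y) (Z y)) = f * fun y ↦ inner ℝ (X y) (Z y) := by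
      ext y; simp [inner_smul_left]
    have h2 : (fun y ↦ inner ℝ ((f • X) y) (Y y)) = f * fun y ↦ inner ℝ (X y) (Y y) := by
      ext y; simp [inner_smul_left]
    simp only [koszul]
    rw [h1, h2, mvfderiv_mul hf (mdifferentiableAt_inner hX hZ), mvfderiv_mul hf (mdifferentiableAt_inner hX hY),
      mlieBracket_smul_left hf hX, mlieBracket_smul_left hf hX]
    simp [inner_add_left, inner_smul_left, inner_smul_right]
    ring
  add {X X'} hX hX' := by
    have h1 : (fun y ↦ inner ℝ ((X + X') y) (Z y)) =
        (fun y ↦ inner ℝ (X y) (Z y)) + fun y ↦ inner ℝ (X' y) (Z y) := by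
      ext y; simp [inner_add_left]
    have h2 : (fun y ↦ inner ℝ ((X + X') y) (Y y)) =
        (fun y ↦ inner ℝ (X y) (Y y)) + fun y ↦ inner ℝ (X' y) (Y y) := by
      ext y; simp [inner_add_left]
    simp only [koszul]
    rw [h1, h2, mvfderiv_add (mdifferentiableAt_inner hX hZ) (mdifferentiableAt_inner hX' hZ),
      mvfderiv_add (mdifferentiableAt_inner hX hY) (mdifferentiableAt_inner hX' hY),
      mlieBracket_add_left hX hX', mlieBracket_add_left hX hX']
    simp [inner_add_left, inner_add_right]
    ring

theorem koszul_tensorial_right {Y X : Π x : M, TangentSpace I x} {x : M}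
    (hY : MDiffAt (T% Y) x) (hX : MDiffAt (T% X) x) :
    TensorialAt I E (fun Z ↦ koszul Y X Z x) x where
  smul {f Z} hf hZ := by
    have h1 : (fun y ↦ inner ℝ (X y) ((f • Z) y)) = f * fun y ↦ inner ℝ (X y) (Z y) := by
      ext y; simp [inner_smul_right]
    have h2 : (fun y ↦ inner ℝ (Y y) ((f • Z) y)) = f * fun y ↦ inner ℝ (Y y) (Z y) := by
      ext y; simp [inner_smul_right]
    simp only [koszul]
    rw [h1, h2, mvfderiv_mul hf (mdifferentiableAt_inner hX hZ), mvfderiv_mul hf (mdifferentiableAt_inner hY hZ),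
      mlieBracket_smul_right hf hZ, mlieBracket_smul_right hf hZ]
    simp [inner_add_left, inner_smul_left, inner_smul_right]
    rw [real_inner_comm (Z x) (X x), real_inner_comm (Z x) (Y x)]
    ring
  add {Z Z'} hZ hZ' := by
    have h1 : (fun y ↦ inner ℝ (X y) ((Z + Z') y)) =
        (fun y ↦ inner ℝ (X y) (Z y)) + fun y ↦ inner ℝ (X y) (Z' y) := by
      ext y; simp [inner_add_right]
    have h2 : (fun y ↦ inner ℝ (Y y) ((Z + Z') y)) =
        (fun y ↦ inner ℝ (Y y) (Z y)) + fun y ↦ inner ℝ (Y y) (Z' y) := by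
      ext y; simp [inner_add_right]
    simp only [koszul]
    rw [h1, h2, mvfderiv_add (mdifferentiableAt_inner hX hZ) (mdifferentiableAt_inner hX hZ'),
      mvfderiv_add (mdifferentiableAt_inner hY hZ) (mdifferentiableAt_inner hY hZ'),
      mlieBracket_add_right hZ hZ', mlieBracket_add_right hZ hZ']
    simp [inner_add_left, inner_add_right]
    ring

instance finiteDimensional_tangentSpace (x : M) : FiniteDimensional ℝ (TangentSpace I x) :=
  inferInstanceAs (FiniteDimensional ℝ E)

instance completeSpace_tangentSpace (x : M) : CompleteSpace (TangentSpace I x) :=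
  FiniteDimensional.complete ℝ _

open Classical in
/-- The Levi-Civita connection as a bare function: `leviCivitaFun Y x v` is `∇_v Y`, the vector
that represents the linear form `z ↦ koszul Y X Z x`, where the fields `X` and `Z` extend `v` and
`z`. Only its values at points where `Y` is differentiable are meaningful. -/
def leviCivitaFun (Y : Π x : M, TangentSpace I x) (x : M) :
    TangentSpace I x →L[ℝ] TangentSpace I x :=
  if hY : MDiffAt (T% Y) x then
    LinearMap.toContinuousLinearMap
      { toFun v := (InnerProductSpace.toDual ℝ (TangentSpace I x)).symm
          (TensorialAt.mkHom₂ (fun X Z ↦ koszul Y X Z x) x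
            (fun _ hZ ↦ koszul_tensorial_left hY hZ)
            (fun _ hX ↦ koszul_tensorial_right hY hX) v)
        map_add' v w := by simp
        map_smul' c v := by simp }
  else 0

theorem inner_leviCivitaFun {X Y Z : Π x : M, TangentSpace I x} {x : M}
    (hX : MDiffAt (T% X) x) (hY : MDiffAt (T% Y) x) (hZ : MDiffAt (T% Z) x) :
    inner ℝ (leviCivitaFun Y x (X x)) (Z x) = koszul Y X Z x := by
  rw [leviCivitaFun, dif_pos hY]
  simp only [LinearMap.coe_toContinuousLinearMap', LinearMap.coe_mk, AddHom.coe_mk,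
    InnerProductSpace.toDual_symm_apply]
  exact TensorialAt.mkHom₂_apply _ _ hX hZ

theorem ext_inner_fields {x : M} {A B : TangentSpace I x →L[ℝ] TangentSpace I x}
    (h : ∀ X Z : Π x : M, TangentSpace I x, MDiffAt (T% X) x → MDiffAt (T% Z) x →
      inner ℝ (A (X x)) (Z x) = inner ℝ (B (X x)) (Z x)) : A = B := by
  ext1 v
  refine ext_inner_right ℝ fun w ↦ ?_
  simpa using h (extend E v) (extend E w) (mdifferentiableAt_extend ..)
    (mdifferentiableAt_extend ..)

/-- The Levi-Civita connection of a Riemannian manifold. -/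
def leviCivita (I : ModelWithCorners ℝ E H) (M : Type*) [TopologicalSpace M] [ChartedSpace H M]
    [IsManifold I ∞ M] [RiemannianBundle (fun x : M ↦ TangentSpace I x)]
    [IsContMDiffRiemannianBundle I ∞ E (fun x : M ↦ TangentSpace I x)] :
    CovariantDerivative I E (TangentSpace I : M → Type _) where
  toFun := leviCivitaFun
  isCovariantDerivativeOnUniv :=
    { add := by
        intro Y Y' x hY hY' _
        refine ext_inner_fields fun X Z hX hZ ↦ ?_
        have hYY : MDiffAt (T% (Y + Y')) x := mdifferentiableAt_add_section hY hY'
        rw [inner_leviCivitaFun hX hYY hZ, add_apply, inner_add_left,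
          inner_leviCivitaFun hX hY hZ, inner_leviCivitaFun hX hY' hZ]
        have h1 : (fun y ↦ inner ℝ ((Y + Y') y) (Z y)) =
            (fun y ↦ inner ℝ (Y y) (Z y)) + fun y ↦ inner ℝ (Y' y) (Z y) := by
          ext y; simp [inner_add_left]
        have h2 : (fun y ↦ inner ℝ (X y) ((Y + Y') y)) =
            (fun y ↦ inner ℝ (X y) (Y y)) + fun y ↦ inner ℝ (X y) (Y' y) := by
          ext y; simp [inner_add_right]
        simp only [koszul]
        rw [h1, h2, mvfderiv_add (mdifferentiableAt_inner hY hZ) (mdifferentiableAt_inner hY' hZ),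
          mvfderiv_add (mdifferentiableAt_inner hX hY) (mdifferentiableAt_inner hX hY'),
          mlieBracket_add_right hY hY', mlieBracket_add_left hY hY']
        simp [inner_add_left, inner_add_right]
        ring
      leibniz := by
        intro Y f x hY hf _
        refine ext_inner_fields fun X Z hX hZ ↦ ?_
        have hfY : MDiffAt (T% (f • Y)) x := hf.smul_section hY
        rw [inner_leviCivitaFun hX hfY hZ, add_apply, inner_add_left,
          smul_apply, inner_smul_left, inner_leviCivitaFun hX hY hZ]
        have h1 : (fun y ↦ inner ℝ ((f • Y) y) (Z y)) = f * fun y ↦ inner ℝ (Y y) (Z y) := by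
          ext y; simp [inner_smul_left]
        have h2 : (fun y ↦ inner ℝ (X y) ((f • Y) y)) = f * fun y ↦ inner ℝ (X y) (Y y) := by
          ext y; simp [inner_smul_right]
        simp only [koszul]
        rw [h1, h2, mvfderiv_mul hf (mdifferentiableAt_inner hY hZ),
          mvfderiv_mul hf (mdifferentiableAt_inner hX hY),
          mlieBracket_smul_right hf hY, mlieBracket_smul_left hf hY]
        simp [inner_add_left, inner_smul_left, inner_smul_right]
        rw [real_inner_comm (X x) (Y x)]
        ring }

/-- The connection is compatible with the metric. -/
theorem leviCivita_metric {X Y Z : Π x : M, TangentSpace I x} {x : M}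
    (hX : MDiffAt (T% X) x) (hY : MDiffAt (T% Y) x) (hZ : MDiffAt (T% Z) x) :
    mvfderiv I (fun y ↦ inner ℝ (Y y) (Z y)) x (X x) =
      inner ℝ (leviCivita I M Y x (X x)) (Z x) + inner ℝ (Y x) (leviCivita I M Z x (X x)) := by
  change _ = inner ℝ (leviCivitaFun Y x (X x)) (Z x) + inner ℝ (Y x) (leviCivitaFun Z x (X x))
  rw [inner_leviCivitaFun hX hY hZ, real_inner_comm, inner_leviCivitaFun hX hZ hY]
  have h : (fun y ↦ inner ℝ (Z y) (Y y)) = fun y ↦ inner ℝ (Y y) (Z y) := by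
    ext y; rw [real_inner_comm]
  simp only [koszul]
  rw [h, mlieBracket_swap_apply (V := Z) (W := Y), inner_neg_left]
  ring

/-- The connection is torsion-free. -/
theorem leviCivita_torsion : (leviCivita I M).torsion = 0 := by
  rw [CovariantDerivative.torsion_eq_zero_iff]
  intro X Y x hX hY
  refine ext_inner_right ℝ fun w ↦ ?_
  have hZ : MDiffAt (T% (extend E w : Π y : M, TangentSpace I y)) x :=
    mdifferentiableAt_extend ..
  have hw : (extend E w : Π y : M, TangentSpace I y) x = w := by simp
  rw [← hw]
  generalize (extend E w : Π y : M, TangentSpace I y) = Z at hZ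
  change inner ℝ (leviCivitaFun Y x (X x) - leviCivitaFun X x (Y x)) (Z x) = _
  rw [inner_sub_left, inner_leviCivitaFun hX hY hZ, inner_leviCivitaFun hY hX hZ]
  have h : (fun y ↦ inner ℝ (Y y) (X y)) = fun y ↦ inner ℝ (X y) (Y y) := by
    ext y; rw [real_inner_comm]
  simp only [koszul]
  rw [h, mlieBracket_swap_apply (V := Y) (W := X), inner_neg_left]
  ring

/-! ### Curvature -/

/-- `R(U, V)W = ∇_U ∇_V W - ∇_V ∇_U W - ∇_[U,V] W` for vector fields `U`, `V`, `W`. -/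
def curvatureField (U V W : Π x : M, TangentSpace I x) (x : M) : TangentSpace I x :=
  leviCivita I M (fun y ↦ leviCivita I M W y (V y)) x (U x)
    - leviCivita I M (fun y ↦ leviCivita I M W y (U y)) x (V x)
    - leviCivita I M W x (mlieBracket I U V x)

/-- The curvature tensor `R(x)(u, v)w`, computed with the fields `extend E u`, `extend E v`,
`extend E w`, which take the values `u`, `v`, `w` at `x` and are smooth near `x`. -/
def curvature (x : M) (u v w : TangentSpace I x) : TangentSpace I x :=
  curvatureField (extend E u) (extend E v) (extend E w) x

/-- `sup_x ‖R(x)‖ ∈ [0, ∞]`, with `‖R(x)‖` the supremum of `‖R(x)(u, v)w‖ / (‖u‖ ‖v‖ ‖w‖)`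
(a quotient with denominator zero is zero). -/
def curvatureSup (I : ModelWithCorners ℝ E H) (M : Type*) [TopologicalSpace M] [ChartedSpace H M]
    [IsManifold I ∞ M] [RiemannianBundle (fun x : M ↦ TangentSpace I x)]
    [IsContMDiffRiemannianBundle I ∞ E (fun x : M ↦ TangentSpace I x)] : ℝ≥0∞ :=
  ⨆ (x : M) (u : TangentSpace I x) (v : TangentSpace I x) (w : TangentSpace I x),
    ENNReal.ofReal (‖curvature x u v w‖ / (‖u‖ * ‖v‖ * ‖w‖))

/-! ### Functions of class `C²_b` -/

/-- The Riemannian gradient. -/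
def grad (g : M → ℝ) (x : M) : TangentSpace I x :=
  (InnerProductSpace.toDual ℝ (TangentSpace I x)).symm (mvfderiv I g x)

/-- The second covariant derivative `∇²g(x)(v, w) = V(Wg)(x) - (∇_V W)g(x)`, where `V(x) = v` and
`W` is the field `extend E w`, which takes the value `w` at `x` and is smooth near `x`. -/
def secondDeriv (g : M → ℝ) (x : M) (v w : TangentSpace I x) : ℝ :=
  mvfderiv I (fun y ↦ mvfderiv I g y (extend E w y)) x v
    - mvfderiv I g x (leviCivita I M (extend E w) x v)

/-- The `C²_b`-norm of a function, with values in `[0, ∞]`. -/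
def normFun (I : ModelWithCorners ℝ E H) [IsManifold I ∞ M]
    [RiemannianBundle (fun x : M ↦ TangentSpace I x)]
    [IsContMDiffRiemannianBundle I ∞ E (fun x : M ↦ TangentSpace I x)] (g : M → ℝ) : ℝ≥0∞ :=
  ⨆ x : M, ‖g x‖ₑ ⊔ ‖grad (I := I) g x‖ₑ ⊔
    ⨆ (v : TangentSpace I x) (w : TangentSpace I x) (_ : ‖v‖ = 1) (_ : ‖w‖ = 1),
      ‖secondDeriv g x v w‖ₑ

/-- `g ∈ C²_b(M)`. -/
def IsC2b (I : ModelWithCorners ℝ E H) [IsManifold I ∞ M]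
    [RiemannianBundle (fun x : M ↦ TangentSpace I x)]
    [IsContMDiffRiemannianBundle I ∞ E (fun x : M ↦ TangentSpace I x)] (g : M → ℝ) : Prop :=
  ContMDiff I (modelWithCornersSelf ℝ ℝ) 2 g ∧ normFun I g < ⊤

/-! ### Vector fields of class `𝔛²_b` -/

/-- The second covariant derivative `∇²V(x)(v, w) = (∇_v ∇_W V)(x) - (∇_{∇_v W} V)(x)` of a
vector field, where `W` is the field `extend E w`, which takes the value `w` at `x` and is smooth
near `x`. -/
def secondCovDeriv (V : Π x : M, TangentSpace I x) (x : M) (v w : TangentSpace I x) :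
    TangentSpace I x :=
  leviCivita I M (fun y ↦ leviCivita I M V y (extend E w y)) x v
    - leviCivita I M V x (leviCivita I M (extend E w) x v)

/-- The `𝔛²_b`-norm of a vector field, with values in `[0, ∞]`. -/
def normField (V : Π x : M, TangentSpace I x) : ℝ≥0∞ :=
  ⨆ x : M, ‖V x‖ₑ ⊔
    (⨆ (v : TangentSpace I x) (_ : ‖v‖ = 1), ‖leviCivita I M V x v‖ₑ) ⊔
    ⨆ (v : TangentSpace I x) (w : TangentSpace I x) (_ : ‖v‖ = 1) (_ : ‖w‖ = 1),
      ‖secondCovDeriv V x v w‖ₑ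

/-- `V ∈ 𝔛²_b(M)`. -/
def IsX2b (V : Π x : M, TangentSpace I x) : Prop :=
  ContMDiff I I.tangent 2 (fun x ↦ (V x : TangentBundle I M)) ∧ normField V < ⊤

/-- `X t x = x_t(x)` is the global flow of `V`: for each `x`, the curve `t ↦ X t x` solves
`d/dt X t x = V (X t x)` on all of `ℝ`, with `X 0 x = x`. -/
def IsFlow (V : Π x : M, TangentSpace I x) (X : ℝ → M → M) : Prop :=
  ∀ x : M, X 0 x = x ∧ IsMIntegralCurve (fun t ↦ X t x) V

end RiemannianFlow

end

noncomputable section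

namespace RiemannianFlow

/-! ### Local flows in Banach spaces -/

section Nemytskii

universe u
variable {X : Type*} [TopologicalSpace X] [CompactSpace X]
  {E F : Type u} [NormedAddCommGroup E] [NormedSpace ℝ E] [NormedAddCommGroup F] [NormedSpace ℝ F]

/-! Write `J_s v` for the derivative of the flow `X s` at `x` applied to `v`, and let `A`, `L`, `K`
be the bounds on `g`, `V` and the curvature.

Existence of the flow: `V` is bounded, so integral curves are Lipschitz in time. Over a bounded time
interval the points they reach form a totally bounded set, whose closure is compact by completeness.
Local existence times are bounded below on this compact set, so integral curves can always be
prolonged (`exists_isMIntegralCurve_of_bounded`).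

Regularity: in a chart, the Picard equation `γ = x + ε ∫ f ∘ γ` is solved by the inverse function
theorem in a Banach space of curves, so its solution is `C²` in `x` (`exists_contDiff_picard`).
Differentiating the equation in `x` also gives the time derivatives at time zero of the first two
spatial derivatives (`exists_local_flow`). The group law carries both conclusions to all times.

Estimates: compatibility of the connection with the metric gives `d/ds ‖J_s v‖² = 2⟨∇_{J_s v} V, J_s
v⟩`, hence `‖J_s v‖ ≤ e^{Ls} ‖v‖` (`norm_mfderiv_flow_le`); this bounds the gradient of `g ∘ X t`.
For the second derivative, put `h(s) = ∇²(g ∘ X_{t-s})(J_s v, J_s w)`, evaluated at `X_s x`. Then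
`h(0)` is the quantity sought, `h(t)` is `∇²g` on transported vectors, and `h'(s) = -d(g ∘
X_{t-s})(∇²V(J_s v, J_s w) + R(V, J_s v) J_s w)` (`hasDerivAt_transportedSecondDeriv`). The bracket
is the Lie derivative of the connection along `V`, which is how curvature enters. All factors on the
right are already bounded, so the mean value inequality concludes. Only pointwise norms occur, so
the constant does not see the dimension.

The derivatives of `‖J_s v‖²` and `h` are computed in one chart at `s = 0`, with Christoffel
symbols; there the formulas for `∇²V` and `R` combine into the coordinate expression of this Lie
derivative (`chartCoord_secondCovDeriv_add_curvature`). -/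

/-- The Nemytskii operator `γ ↦ f ∘ γ` on continuous curves. -/
def nemytskii (X : Type*) [TopologicalSpace X] {f : E → F} (hf : Continuous f) (γ : C(X, E)) :
    C(X, F) :=
  ContinuousMap.comp ⟨f, hf⟩ γ

instance normedAddCommGroupCurveCLM : NormedAddCommGroup C(X, E →L[ℝ] F) :=
  ContinuousMap.instNormedAddCommGroup

instance normedSpaceCurveCLM : NormedSpace ℝ C(X, E →L[ℝ] F) :=
  ContinuousMap.normedSpace

/-- Pointwise application of a continuous family of linear maps to a continuous curve. -/
def pointwiseApplyₗ (X : Type*) [TopologicalSpace X] [CompactSpace X] (E F : Type u)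
    [NormedAddCommGroup E] [NormedSpace ℝ E] [NormedAddCommGroup F] [NormedSpace ℝ F] :
    C(X, E →L[ℝ] F) →ₗ[ℝ] C(X, E) →ₗ[ℝ] C(X, F) :=
  LinearMap.mk₂ ℝ (fun A γ ↦ ⟨fun t ↦ A t (γ t), A.continuous.clm_apply γ.continuous⟩)
    (fun _ _ _ ↦ by ext; simp) (fun _ _ _ ↦ by ext; simp) (fun _ _ _ ↦ by ext; simp)
    (fun _ _ _ ↦ by ext; simp)

/-- Pointwise application of a continuous family of linear maps to a continuous curve, as a
continuous bilinear map. -/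
def pointwiseApply (X : Type*) [TopologicalSpace X] [CompactSpace X] (E F : Type u)
    [NormedAddCommGroup E] [NormedSpace ℝ E] [NormedAddCommGroup F] [NormedSpace ℝ F] :
    C(X, E →L[ℝ] F) →L[ℝ] C(X, E) →L[ℝ] C(X, F) :=
  LinearMap.mkContinuous₂ (pointwiseApplyₗ X E F) 1 (by
    intro A γ
    rw [one_mul]
    refine (ContinuousMap.norm_le _ (by positivity)).2 fun t ↦ ?_
    exact ((A t).le_opNorm _).trans
      (mul_le_mul (A.norm_coe_le_norm t) (γ.norm_coe_le_norm t) (norm_nonneg _) (norm_nonneg _)))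

theorem continuous_nemytskii {f : E → F} (hf : Continuous f) :
    Continuous (nemytskii X hf) :=
  ContinuousMap.continuous_postcomp _

/-- The mean value inequality is applied at each `t`. The error is uniform in `t` because `γ ↦ f' ∘
γ` is continuous for the sup norm, so no uniform continuity of `f'` on `E` is required. -/
theorem hasFDerivAt_nemytskii {f : E → F} {f' : E → E →L[ℝ] F} (hf : Continuous f)
    (hf' : Continuous f') (h : ∀ x, HasFDerivAt f (f' x) x) (γ : C(X, E)) :
    HasFDerivAt (nemytskii X hf) (pointwiseApply X E F (nemytskii X hf' γ)) γ := by
  rw [hasFDerivAt_iff_isLittleO, Asymptotics.isLittleO_iff]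
  intro c hc
  obtain ⟨δ, hδ, H⟩ := Metric.continuous_iff.1 (continuous_nemytskii (X := X) hf') γ c hc
  filter_upwards [Metric.ball_mem_nhds γ hδ] with γ' hγ'
  refine (ContinuousMap.norm_le _ (by positivity)).2 fun t ↦ ?_
  have key : ‖f (γ' t) - f (γ t) - f' (γ t) (γ' t - γ t)‖ ≤ c * ‖γ' t - γ t‖ := by
    refine (convex_segment (γ t) (γ' t)).norm_image_sub_le_of_norm_hasFDerivWithin_le'
      (f' := f') (fun z _ ↦ (h z).hasFDerivWithinAt) ?_ (left_mem_segment ..)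
      (right_mem_segment ..)
    rintro z ⟨a, b, ha, hb, hab, rfl⟩
    -- A point of the segment from `γ t` to `γ' t` is the value at `t` of a curve that is itself
    -- `δ`-close to `γ`.
    have hd : dist (a • γ + b • γ') γ < δ := by
      have : a • γ + b • γ' - γ = b • (γ' - γ) := by
        rw [show a = 1 - b by linarith]; module
      rw [dist_eq_norm, this, norm_smul, Real.norm_of_nonneg hb, ← dist_eq_norm]
      calc b * dist γ' γ ≤ 1 * dist γ' γ := by gcongr; linarith
        _ < δ := by simpa using hγ'
    have := (ContinuousMap.dist_apply_le_dist (f := nemytskii X hf' (a • γ + b • γ'))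
      (g := nemytskii X hf' γ) t).trans (H _ hd).le
    rwa [dist_eq_norm] at this
  refine (show _ ≤ c * ‖γ' t - γ t‖ from key).trans ?_
  gcongr
  exact (γ' - γ).norm_coe_le_norm t

/-- The derivative is pointwise application of the Nemytskii operator of `fderiv ℝ f`. The induction
therefore passes from `F` to `E →L[ℝ] F`, which is why both spaces share a universe. -/
theorem contDiff_nemytskii (n : ℕ) {E F : Type u} [NormedAddCommGroup E] [NormedSpace ℝ E]
    [NormedAddCommGroup F] [NormedSpace ℝ F] {f : E → F} (hf : ContDiff ℝ n f) :
    ContDiff ℝ n (nemytskii X hf.continuous) := by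
  induction n generalizing F with
  | zero => exact contDiff_zero.2 (continuous_nemytskii _)
  | succ n ih =>
    have hf1 : ContDiff ℝ (n + 1 : ℕ) f := hf
    rw [Nat.cast_add, Nat.cast_one, contDiff_succ_iff_fderiv] at hf1
    have h2 := hf1.2.2
    refine (contDiff_succ_iff_hasFDerivAt (n := n)).2
      ⟨fun γ ↦ pointwiseApply X E F (nemytskii X h2.continuous γ),
        (pointwiseApply X E F).contDiff.comp (ih h2), fun γ ↦ ?_⟩
    exact hasFDerivAt_nemytskii _ _ (fun x ↦ (hf1.1 x).hasFDerivAt) γ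

end Nemytskii

/-! ### Integration of curves on `[-1, 1]`. -/

section Integral

variable (E : Type*) [NormedAddCommGroup E] [NormedSpace ℝ E]

/-- The space of continuous curves on `[-1, 1]`. -/
abbrev Curve := C(Set.Icc (-1 : ℝ) 1, E)

variable {E}

/-- A curve on `[-1, 1]`, extended to `ℝ` by constants. -/
def Curve.ext (γ : Curve E) (t : ℝ) : E := γ (Set.projIcc (-1) 1 (by norm_num) t)

theorem Curve.continuous_ext (γ : Curve E) : Continuous γ.ext :=
  γ.continuous.comp continuous_projIcc

theorem Curve.norm_ext_le (γ : Curve E) (t : ℝ) : ‖γ.ext t‖ ≤ ‖γ‖ := γ.norm_coe_le_norm _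

variable (E) in
/-- The operator `γ ↦ ∫₀ γ` on curves. -/
def primitive : Curve E →L[ℝ] Curve E :=
  LinearMap.mkContinuous
    { toFun γ := ⟨fun t ↦ ∫ τ in (0 : ℝ)..t, γ.ext τ,
        (intervalIntegral.continuous_primitive
          (fun a b ↦ γ.continuous_ext.intervalIntegrable a b) 0).comp continuous_subtype_val⟩
      map_add' γ η := by
        ext t
        exact intervalIntegral.integral_add (γ.continuous_ext.intervalIntegrable ..)
          (η.continuous_ext.intervalIntegrable ..)
      map_smul' c γ := by
        ext t
        exact intervalIntegral.integral_smul c _ } 1 (by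
    intro γ
    rw [one_mul]
    refine (ContinuousMap.norm_le _ (norm_nonneg _)).2 fun t ↦ ?_
    refine (intervalIntegral.norm_integral_le_of_norm_le_const
      (fun τ _ ↦ γ.norm_ext_le τ)).trans ?_
    have : |(t : ℝ) - 0| ≤ 1 := by rw [sub_zero]; exact abs_le.2 t.2
    exact mul_le_of_le_one_right (norm_nonneg _) this)

theorem primitive_apply (γ : Curve E) (t : Set.Icc (-1 : ℝ) 1) :
    primitive E γ t = ∫ τ in (0 : ℝ)..t, γ.ext τ := rfl

theorem primitive_ext_hasDerivAt [CompleteSpace E] (γ : Curve E) {t : ℝ}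
    (ht : t ∈ Set.Ioo (-1 : ℝ) 1) : HasDerivAt (primitive E γ).ext (γ.ext t) t := by
  have h := intervalIntegral.integral_hasDerivAt_right
    (γ.continuous_ext.intervalIntegrable 0 t) (γ.continuous_ext.stronglyMeasurableAtFilter _ _)
    γ.continuous_ext.continuousAt
  refine h.congr_of_eventuallyEq ?_
  filter_upwards [Ioo_mem_nhds ht.1 ht.2] with s hs
  rw [Curve.ext, primitive_apply, Set.projIcc_of_mem _ ⟨hs.1.le, hs.2.le⟩]

theorem primitive_ext_zero (γ : Curve E) : (primitive E γ).ext 0 = 0 := by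
  rw [Curve.ext, primitive_apply, Set.projIcc_of_mem _ ⟨by norm_num, by norm_num⟩]
  simp

end Integral

/-! ### The Picard equation through the inverse function theorem. -/

section LocalFlow

variable {E : Type*} [NormedAddCommGroup E] [NormedSpace ℝ E] [CompleteSpace E]

/-- The constant curves, as a linear map. -/
def constCurve (E : Type*) [NormedAddCommGroup E] [NormedSpace ℝ E] : E →L[ℝ] Curve E :=
  LinearMap.mkContinuous
    { toFun x := ContinuousMap.const _ x
      map_add' _ _ := rfl
      map_smul' _ _ := rfl } 1 (fun x ↦ by
    rw [one_mul]; exact (ContinuousMap.norm_le _ (norm_nonneg _)).2 fun t ↦ le_rfl)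

/-- `(δ, η) ↦ (δ, η - δ p)` as an equivalence. -/
def shearEquiv {F : Type*} [NormedAddCommGroup F] [NormedSpace ℝ F] (p : F) :
    (ℝ × F) ≃L[ℝ] (ℝ × F) :=
  ContinuousLinearEquiv.equivOfInverse
    ((ContinuousLinearMap.fst ℝ ℝ F).prod
      (ContinuousLinearMap.snd ℝ ℝ F - (ContinuousLinearMap.fst ℝ ℝ F).smulRight p))
    ((ContinuousLinearMap.fst ℝ ℝ F).prod
      (ContinuousLinearMap.snd ℝ ℝ F + (ContinuousLinearMap.fst ℝ ℝ F).smulRight p))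
    (fun x ↦ by simp) (fun x ↦ by simp)

/-- The Picard equation `γ = x + ε ∫ f ∘ γ` has, for some fixed `ε > 0`, a solution
that is a `Cⁿ` function of the initial value `x`. -/
theorem exists_contDiff_picard (n : ℕ) (hn : n ≠ 0) {f : E → E} (hf : ContDiff ℝ n f) (y : E)
    {r : ℝ} (hr : 0 < r) :
    ∃ ε : ℝ, 0 < ε ∧ ∃ Γ : E → Curve E, ∀ᶠ x in nhds y, ContDiffAt ℝ n Γ x ∧
      Γ x = constCurve E x + ε • primitive E (nemytskii _ hf.continuous (Γ x)) ∧
      ‖Γ x - constCurve E y‖ < r := by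
  set N : Curve E → Curve E := nemytskii _ hf.continuous
  have hN : ContDiff ℝ n N := contDiff_nemytskii n hf
  -- The parameter `ε` is kept as a coordinate. At `ε = 0` the derivative is a shear, invertible
  -- without any smallness estimate.
  set G : ℝ × Curve E → ℝ × Curve E := fun p ↦ (p.1, p.2 - p.1 • primitive E (N p.2))
  have hG : ContDiff ℝ n G := by
    refine contDiff_fst.prodMk (contDiff_snd.sub (contDiff_fst.smul ?_))
    exact (primitive E).contDiff.comp (hN.comp contDiff_snd)
  set c := constCurve E y
  have hn' : (n : WithTop ℕ∞) ≠ 0 := by exact_mod_cast hn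
  have hG' : HasFDerivAt G (shearEquiv (primitive E (N c)) : (ℝ × Curve E) →L[ℝ] (ℝ × Curve E))
      (0, c) := by
    have h1 : HasFDerivAt (fun p : ℝ × Curve E ↦ p.1) (ContinuousLinearMap.fst ℝ ℝ (Curve E))
      (0, c) := hasFDerivAt_fst
    have h2 : HasFDerivAt (fun p : ℝ × Curve E ↦ p.2) (ContinuousLinearMap.snd ℝ ℝ (Curve E))
      (0, c) := hasFDerivAt_snd
    have h3 : DifferentiableAt ℝ (fun p : ℝ × Curve E ↦ primitive E (N p.2)) (0, c) :=
      (((primitive E).contDiff.comp (hN.comp contDiff_snd)).differentiable hn').differentiableAt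
    refine (h1.prodMk (h2.sub (h1.smul h3.hasFDerivAt))).congr_fderiv ?_
    ext p <;> simp [shearEquiv]
  have hG0 : G (0, c) = (0, c) := by simp [G]
  set L := (hG.contDiffAt (x := (0, c))).localInverse hG' hn'
  have hL : ContDiffAt ℝ n L (0, c) := by
    have := (hG.contDiffAt (x := (0, c))).to_localInverse hG' hn'
    rwa [hG0] at this
  have hL0 : L (0, c) = (0, c) := by
    have := (hG.contDiffAt (x := (0, c))).localInverse_apply_image hG' hn'
    rwa [hG0] at this
  have hR : ∀ᶠ p in nhds ((0 : ℝ), c), G (L p) = p := by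
    have := ((hG.contDiffAt (x := (0, c))).hasStrictFDerivAt' hG' hn').eventually_right_inverse
    rwa [hG0] at this
  have hev : ∀ᶠ p in nhds ((0 : ℝ), c), ContDiffAt ℝ n L p ∧ G (L p) = p ∧
      ‖(L p).2 - c‖ < r := by
    refine (hL.eventually (by simp)).and (hR.and ?_)
    have : ContinuousAt (fun p ↦ ‖(L p).2 - c‖) (0, c) :=
      (hL.continuousAt.snd.sub continuousAt_const).norm
    refine this.eventually_lt continuousAt_const ?_
    simpa [hL0] using hr
  have hev2 : ∀ᶠ p : ℝ × E in nhds (0, y), ContDiffAt ℝ n L (p.1, constCurve E p.2) ∧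
      G (L (p.1, constCurve E p.2)) = (p.1, constCurve E p.2) ∧
      ‖(L (p.1, constCurve E p.2)).2 - c‖ < r := by
    have : ContinuousAt (fun p : ℝ × E ↦ (p.1, constCurve E p.2)) (0, y) :=
      (continuous_fst.prodMk ((constCurve E).continuous.comp continuous_snd)).continuousAt
    exact this.eventually hev
  -- A product neighbourhood of `(0, y)` yields one positive `ε` that serves all `x` near `y`.
  rw [nhds_prod_eq] at hev2
  obtain ⟨pa, ha, pb, hb, H⟩ := Filter.eventually_prod_iff.1 hev2
  obtain ⟨ε, hε, hεpos⟩ : ∃ ε, pa ε ∧ 0 < ε := by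
    have := (ha.filter_mono (nhdsWithin_le_nhds (s := Set.Ioi 0))).and self_mem_nhdsWithin
    exact this.exists
  refine ⟨ε, hεpos, fun x ↦ (L (ε, constCurve E x)).2, ?_⟩
  filter_upwards [hb] with x hx
  obtain ⟨h1, h2, h3⟩ := H hε hx
  refine ⟨?_, ?_, h3⟩
  · have h4 : ContDiffAt ℝ n (fun x : E ↦ (ε, constCurve E x)) x :=
      (contDiff_const.prodMk (constCurve E).contDiff).contDiffAt
    exact (h1.comp x h4).snd
  · have e1 := congrArg Prod.fst h2
    have e2 := congrArg Prod.snd h2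
    simp only [G] at e1 e2
    rw [e1] at e2
    exact sub_eq_iff_eq_add.1 e2

end LocalFlow

/-! ### Local flows in finite-dimensional spaces -/

section FiniteDimensional

variable {E : Type*} [NormedAddCommGroup E] [NormedSpace ℝ E] [FiniteDimensional ℝ E]
  {F : Type*} [NormedAddCommGroup F] [NormedSpace ℝ F]

/-- Multiplication by a bump function: the Nemytskii operator needs `f` to be regular on all of `E`.
For finite `n`, regularity at `y` spreads to a ball; this may fail for `n = ⊤`. -/
theorem exists_contDiff_eventuallyEq {n : ℕ∞} {f : E → F} {y : E} (hf : ContDiffAt ℝ n f y)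
    (hn : n ≠ ⊤) : ∃ g : E → F, ContDiff ℝ n g ∧ g =ᶠ[nhds y] f := by
  have hev : ∀ᶠ x in nhds y, ContDiffAt ℝ n f x := hf.eventually (by exact_mod_cast hn)
  obtain ⟨r, hr, H⟩ := Metric.eventually_nhds_iff_ball.1 hev
  let χ : ContDiffBump y := ⟨r / 4, r / 2, by positivity, by linarith⟩
  refine ⟨fun x ↦ χ x • f x, contDiff_iff_contDiffAt.2 fun x ↦ ?_, ?_⟩
  · by_cases hx : x ∈ tsupport χ
    · refine χ.contDiff.contDiffAt.smul (H x ?_)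
      rw [χ.tsupport_eq] at hx
      exact Metric.closedBall_subset_ball (by change r / 2 < r; linarith) hx
    · have h0 : χ =ᶠ[nhds x] 0 := notMem_tsupport_iff_eventuallyEq.1 hx
      refine (contDiffAt_const (c := (0 : F))).congr_of_eventuallyEq ?_
      filter_upwards [h0] with z hz
      simp [hz]
  · filter_upwards [χ.eventuallyEq_one] with z hz
    simp [hz]

theorem hasDerivAt_clm_of_apply {A : ℝ → E →L[ℝ] F} {A' : E →L[ℝ] F} {t : ℝ}
    (h : ∀ a, HasDerivAt (fun s ↦ A s a) (A' a) t) : HasDerivAt A A' t := by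
  let b := Module.finBasis ℝ E
  have key : ∀ B : E →L[ℝ] F, B = ∑ i, (LinearMap.toContinuousLinearMap (b.coord i)).smulRight
      (B (b i)) := by
    intro B
    ext x
    conv_lhs => rw [← b.sum_repr x]
    simp only [map_sum, map_smul, sum_apply, ContinuousLinearMap.smulRight_apply]
    rfl
  have h2 : HasDerivAt (fun s ↦ ∑ i, (LinearMap.toContinuousLinearMap (b.coord i)).smulRight
      (A s (b i))) (∑ i, (LinearMap.toContinuousLinearMap (b.coord i)).smulRight (A' (b i))) t := by
    refine HasDerivAt.fun_sum fun i _ ↦ ?_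
    exact ((ContinuousLinearMap.smulRightL ℝ E F
      (LinearMap.toContinuousLinearMap (b.coord i))).hasFDerivAt.comp_hasDerivAt t (h (b i)))
  rw [← key] at h2
  exact h2.congr_of_eventuallyEq (Filter.Eventually.of_forall fun s ↦ key (A s))

end FiniteDimensional

/-! ### Local flows and their spatial derivatives at time zero. -/

section Flow

variable {E : Type*} [NormedAddCommGroup E] [NormedSpace ℝ E] [FiniteDimensional ℝ E]

/-- Evaluation of a curve at a time, as a linear map. -/
def evalCurve (t : ℝ) : Curve E →L[ℝ] E :=
  ContinuousMap.evalCLM ℝ (Set.projIcc (-1) 1 (by norm_num) t)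

theorem evalCurve_apply (t : ℝ) (γ : Curve E) : evalCurve t γ = γ.ext t := rfl

theorem fderiv_fderiv_clm_comp {F G : Type*} [NormedAddCommGroup F] [NormedSpace ℝ F]
    [NormedAddCommGroup G] [NormedSpace ℝ G] (L : F →L[ℝ] G) {Φ : E → F} {x : E}
    (hΦ : ContDiffAt ℝ 2 Φ x) (a b : E) :
    fderiv ℝ (fun x ↦ L (Φ x)) x a = L (fderiv ℝ Φ x a) ∧
    fderiv ℝ (fderiv ℝ (fun x ↦ L (Φ x))) x a b = L (fderiv ℝ (fderiv ℝ Φ) x a b) := by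
  have h1 : ∀ᶠ z in nhds x, fderiv ℝ (fun x ↦ L (Φ x)) z = L.comp (fderiv ℝ Φ z) := by
    filter_upwards [hΦ.eventually (by simp)] with z hz
    exact (L.hasFDerivAt.comp z (hz.differentiableAt (by simp)).hasFDerivAt).fderiv
  refine ⟨by rw [h1.self_of_nhds]; rfl, ?_⟩
  rw [Filter.EventuallyEq.fderiv_eq h1]
  have h2 : DifferentiableAt ℝ (fderiv ℝ Φ) x :=
    (hΦ.fderiv_right (m := 1) le_rfl).differentiableAt (by simp)
  have h3 := ((ContinuousLinearMap.compL ℝ E F G L).hasFDerivAt.comp x h2.hasFDerivAt).fderiv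
  exact congrArg (fun B ↦ B a b) h3

/-- The shape of the Picard equation: the initial value enters linearly and disappears from the
second derivative. -/
theorem fderiv_fderiv_clm_add_clm_comp {F G : Type*} [NormedAddCommGroup F] [NormedSpace ℝ F]
    [NormedAddCommGroup G] [NormedSpace ℝ G] (c : E →L[ℝ] F) (L : G →L[ℝ] F) {Φ : E → F}
    {Ψ : E → G} {x : E} (hΨ : ContDiffAt ℝ 2 Ψ x) (h : Φ =ᶠ[nhds x] fun x ↦ c x + L (Ψ x))
    (a b : E) :
    fderiv ℝ Φ x a = c a + L (fderiv ℝ Ψ x a) ∧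
    fderiv ℝ (fderiv ℝ Φ) x a b = L (fderiv ℝ (fderiv ℝ Ψ) x a b) := by
  have h1 : ∀ᶠ z in nhds x, fderiv ℝ Φ z = c + fderiv ℝ (fun x ↦ L (Ψ x)) z := by
    filter_upwards [h.eventually_nhds, hΨ.eventually (by simp)] with z hz hz2
    rw [Filter.EventuallyEq.fderiv_eq hz]
    have hd : DifferentiableAt ℝ (fun x ↦ L (Ψ x)) z :=
      (L.contDiff.contDiffAt.comp z hz2).differentiableAt (by simp)
    exact (c.hasFDerivAt.add hd.hasFDerivAt).fderiv
  rw [h1.self_of_nhds, Filter.EventuallyEq.fderiv_eq h1, fderiv_const_add, add_apply]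
  exact ⟨by rw [(fderiv_fderiv_clm_comp L hΨ a b).1], (fderiv_fderiv_clm_comp L hΨ a b).2⟩

/-- The flow is `ψ s x = Γ x (s / ε)` for the Picard solution `Γ`. Differentiating the integral
equation in `x` inside the space of curves leaves primitives in time, so time and space derivatives
need not be interchanged by hand. -/
theorem exists_local_flow {f : E → E} {y : E} (hf : ContDiffAt ℝ 2 f y) {S : Set E}
    (hS : S ∈ nhds y) :
    ∃ ε : ℝ, 0 < ε ∧ ∃ ψ : ℝ → E → E,
      (∀ᶠ x in nhds y, ψ 0 x = x ∧ ∀ s ∈ Set.Ioo (-ε) ε, ψ s x ∈ S ∧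
        HasDerivAt (fun s ↦ ψ s x) (f (ψ s x)) s ∧ ContDiffAt ℝ 2 (ψ s) x) ∧
      HasDerivAt (fun s ↦ fderiv ℝ (ψ s) y) (fderiv ℝ f y) 0 ∧
      ∀ a b, HasDerivAt (fun s ↦ fderiv ℝ (fderiv ℝ (ψ s)) y a b)
        (fderiv ℝ (fderiv ℝ f) y a b) 0 := by
  obtain ⟨g, hg, hgf⟩ := exists_contDiff_eventuallyEq (n := 2) hf (by decide)
  obtain ⟨r, hr, hrS⟩ := Metric.eventually_nhds_iff_ball.1
    (hgf.and (Filter.eventually_mem_set.2 hS))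
  obtain ⟨ε, hε, Γ, hΓ⟩ := exists_contDiff_picard 2 (by simp) (f := g) hg y hr
  set N := nemytskii (Set.Icc (-1 : ℝ) 1) hg.continuous
  have hmem : ∀ s ∈ Set.Ioo (-ε) ε, s / ε ∈ Set.Ioo (-1 : ℝ) 1 := fun s hs ↦
    ⟨by rw [lt_div_iff₀ hε]; linarith [hs.1], by rw [div_lt_one hε]; exact hs.2⟩
  have hN : ContDiff ℝ 2 N := contDiff_nemytskii 2 hg
  have hΓ0 : ∀ᶠ x in nhds y, (Γ x).ext 0 = x := by
    filter_upwards [hΓ] with x hx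
    rw [hx.2.1]
    change x + ε • (primitive E (N (Γ x))).ext 0 = x
    rw [primitive_ext_zero, smul_zero, add_zero]
  -- The factor `1 / ε` from the rescaled time cancels the `ε` in front of the integral.
  have hder : ∀ (x : E) (c : E) (η : Curve E) (s : ℝ), s ∈ Set.Ioo (-ε) ε →
      HasDerivAt (fun s ↦ (constCurve E c + ε • primitive E η).ext (s / ε)) (η.ext (s / ε)) s := by
    intro x c η s hs
    have h1 := primitive_ext_hasDerivAt η (hmem s hs)
    have h2 : HasDerivAt (fun s : ℝ ↦ s / ε) (1 / ε) s := (hasDerivAt_id s).div_const ε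
    have h3 := ((h1.scomp s h2).const_smul ε).const_add c
    refine h3.congr_deriv ?_
    rw [smul_smul, mul_one_div_cancel hε.ne', one_smul]
  have h0mem : (0 : ℝ) ∈ Set.Ioo (-ε) ε := ⟨by linarith, hε⟩
  have hΓy : ContDiffAt ℝ 2 Γ y := hΓ.self_of_nhds.1
  have hNΓ : ContDiffAt ℝ 2 (fun x ↦ N (Γ x)) y := hN.contDiffAt.comp y hΓy
  -- The integrand at time zero is `f` itself near `y`; this identifies the derivatives at time zero
  -- as those of `f`.
  have hNΓ0 : (fun x ↦ evalCurve 0 (N (Γ x))) =ᶠ[nhds y] f := by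
    filter_upwards [hΓ0, hgf] with x hx hx'
    change g ((Γ x).ext 0) = f x
    rw [hx, hx']
  have hPic : Γ =ᶠ[nhds y] fun x ↦ constCurve E x + (ε • primitive E) (N (Γ x)) := by
    filter_upwards [hΓ] with x hx using hx.2.1
  have hD := fderiv_fderiv_clm_add_clm_comp (constCurve E) (ε • primitive E) hNΓ hPic
  refine ⟨ε, hε, fun s x ↦ evalCurve (s / ε) (Γ x), ?_, ?_, ?_⟩
  · filter_upwards [hΓ, hΓ0] with x hx hx0
    refine ⟨by rw [zero_div]; exact hx0, fun s hs ↦ ?_⟩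
    have hball : (Γ x).ext (s / ε) ∈ Metric.ball y r := by
      rw [mem_ball_iff_norm]
      exact ((Γ x - constCurve E y).norm_ext_le (s / ε)).trans_lt hx.2.2
    refine ⟨(hrS _ hball).2, ?_,
      (evalCurve (E := E) (s / ε)).contDiff.contDiffAt.comp x hx.1⟩
    rw [evalCurve_apply, ← (hrS _ hball).1]
    have := hder x x (N (Γ x)) s hs
    have h2 := hx.2.1
    change Γ x = constCurve E x + ε • primitive E (N (Γ x)) at h2
    rw [← h2] at this
    exact this
  · refine hasDerivAt_clm_of_apply fun a ↦ ?_
    have e1 : ∀ s, fderiv ℝ (fun x ↦ evalCurve (s / ε) (Γ x)) y a =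
        (constCurve E a + ε • primitive E (fderiv ℝ (fun x ↦ N (Γ x)) y a)).ext (s / ε) := by
      intro s
      rw [(fderiv_fderiv_clm_comp _ hΓy a a).1, (hD a a).1]
      rfl
    simp_rw [e1]
    refine (hder y a _ 0 h0mem).congr_deriv ?_
    rw [zero_div, ← evalCurve_apply, ← (fderiv_fderiv_clm_comp _ hNΓ a a).1, hNΓ0.fderiv_eq]
  · intro a b
    have e1 : ∀ s, fderiv ℝ (fderiv ℝ (fun x ↦ evalCurve (s / ε) (Γ x))) y a b =
        (constCurve E 0 + ε • primitive E
          (fderiv ℝ (fderiv ℝ (fun x ↦ N (Γ x))) y a b)).ext (s / ε) := by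
      intro s
      rw [(fderiv_fderiv_clm_comp _ hΓy a b).2, (hD a b).2,
        map_zero, zero_add]
      rfl
    simp_rw [e1]
    refine (hder y 0 _ 0 h0mem).congr_deriv ?_
    rw [zero_div, ← evalCurve_apply, ← (fderiv_fderiv_clm_comp _ hNΓ a b).2]
    rw [hNΓ0.fderiv.fderiv_eq]

end Flow

/-! ### Calculus in a chart -/

section Chart

variable {E : Type*} [NormedAddCommGroup E] [NormedSpace ℝ E]
  {M : Type*} [TopologicalSpace M] [ChartedSpace E M] [IsManifold 𝓘(ℝ, E) ∞ M]
  {F : Type*} [NormedAddCommGroup F] [NormedSpace ℝ F]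

local notation "𝕀" => 𝓘(ℝ, E)

theorem two_le_infty : (2 : ℕ∞ω) ≤ (∞ : ℕ∞ω) :=
  WithTop.coe_le_coe.2 (le_top : (2 : ℕ∞) ≤ ⊤)

/-- The coordinates, in the chart at `y`, of tangent vectors at `z`. -/
def chartCoord (y z : M) : TangentSpace 𝕀 z →L[ℝ] E :=
  (trivializationAt E (TangentSpace 𝕀) y).continuousLinearMapAt ℝ z

/-- The tangent vector at `z` with given coordinates in the chart at `y`. -/
def coordVec (y z : M) : E →L[ℝ] TangentSpace 𝕀 z :=
  (trivializationAt E (TangentSpace 𝕀) y).symmL ℝ z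

/-- A vector field, written in the chart at `y`. -/
def fieldRep (y : M) (Y : Π z : M, TangentSpace 𝕀 z) (p : E) : E :=
  chartCoord y ((extChartAt 𝕀 y).symm p) (Y ((extChartAt 𝕀 y).symm p))

/-- A function, written in the chart at `y`. -/
def funRep (y : M) (g : M → F) (p : E) : F := g ((extChartAt 𝕀 y).symm p)

variable {y z : M}

theorem mem_baseSet_of_mem_source (hz : z ∈ (extChartAt 𝕀 y).source) :
    z ∈ (trivializationAt E (TangentSpace 𝕀) y).baseSet := by
  rwa [TangentBundle.trivializationAt_baseSet, ← extChartAt_source 𝕀]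

@[simp] theorem chartCoord_coordVec (hz : z ∈ (extChartAt 𝕀 y).source) (a : E) :
    chartCoord y z (coordVec y z a) = a :=
  Trivialization.continuousLinearMapAt_symmL _ (mem_baseSet_of_mem_source hz) a

@[simp] theorem coordVec_chartCoord (hz : z ∈ (extChartAt 𝕀 y).source) (v : TangentSpace 𝕀 z) :
    coordVec y z (chartCoord y z v) = v :=
  Trivialization.symmL_continuousLinearMapAt _ (mem_baseSet_of_mem_source hz) v

theorem chartCoord_injective (hz : z ∈ (extChartAt 𝕀 y).source) :
    Function.Injective (chartCoord (E := E) y z) :=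
  fun v w h ↦ by rw [← coordVec_chartCoord hz v, h, coordVec_chartCoord hz]

theorem chartCoord_eq_mfderiv (hz : z ∈ (extChartAt 𝕀 y).source) :
    chartCoord y z = mfderiv 𝕀 𝓘(ℝ, E) (extChartAt 𝕀 y) z :=
  TangentBundle.continuousLinearMapAt_trivializationAt (by rwa [← extChartAt_source 𝕀])

/-- The fields used to define `curvature`, `secondDeriv` and `secondCovDeriv` have constant
coordinates in the chart at the base point, so their coordinate derivatives vanish there. -/
theorem extend_eq_coordVec (v : TangentSpace 𝕀 y) (hz : z ∈ (extChartAt 𝕀 y).source) :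
    (extend E v : Π z : M, TangentSpace 𝕀 z) z = coordVec y z (chartCoord y y v) := by
  rw [coordVec, Trivialization.symmL_apply _ (mem_baseSet_of_mem_source hz), chartCoord,
    Trivialization.continuousLinearMapAt_apply, Trivialization.linearMapAt_apply,
    if_pos (FiberBundle.mem_baseSet_trivializationAt' y)]
  rfl

theorem source_mem_nhds (hz : z ∈ (extChartAt 𝕀 y).source) :
    (extChartAt 𝕀 y).source ∈ nhds z := (isOpen_extChartAt_source y).mem_nhds hz

theorem target_mem_nhds {p : E} (hp : p ∈ (extChartAt 𝕀 y).target) :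
    (extChartAt 𝕀 y).target ∈ nhds p := (isOpen_extChartAt_target y).mem_nhds hp

theorem contMDiffAt_chart {n : ℕ∞ω} (hn : n ≤ (∞ : ℕ∞ω)) (hz : z ∈ (extChartAt 𝕀 y).source) :
    ContMDiffAt 𝕀 𝓘(ℝ, E) n (extChartAt 𝕀 y) z :=
  (contMDiffAt_extChartAt' (n := (∞ : ℕ∞ω)) (by rwa [← extChartAt_source 𝕀])).of_le hn

theorem contMDiffAt_chart_symm {n : ℕ∞ω} (hn : n ≤ (∞ : ℕ∞ω)) {p : E}
    (hp : p ∈ (extChartAt 𝕀 y).target) :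
    ContMDiffAt 𝓘(ℝ, E) 𝕀 n (extChartAt 𝕀 y).symm p :=
  (((contMDiffOn_extChartAt_symm (n := (∞ : ℕ∞ω)) y) p hp).contMDiffAt (target_mem_nhds hp)).of_le hn

theorem mdifferentiableAt_chart (hz : z ∈ (extChartAt 𝕀 y).source) :
    MDifferentiableAt 𝕀 𝓘(ℝ, E) (extChartAt 𝕀 y) z :=
  (contMDiffAt_chart (n := 1) (by simp) hz).mdifferentiableAt (by simp)

theorem mdifferentiableAt_chart_symm {p : E} (hp : p ∈ (extChartAt 𝕀 y).target) :
    MDifferentiableAt 𝓘(ℝ, E) 𝕀 (extChartAt 𝕀 y).symm p :=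
  (contMDiffAt_chart_symm (n := 1) (by simp) hp).mdifferentiableAt (by simp)

theorem funRep_comp_chart (g : M → F) (hz : z ∈ (extChartAt 𝕀 y).source) :
    g =ᶠ[nhds z] (funRep y g ∘ extChartAt 𝕀 y) := by
  filter_upwards [source_mem_nhds hz] with w hw
  rw [Function.comp_apply, funRep, (extChartAt 𝕀 y).left_inv hw]

theorem funRep_chart (g : M → F) (hz : z ∈ (extChartAt 𝕀 y).source) :
    funRep y g (extChartAt 𝕀 y z) = g z := by
  rw [funRep, (extChartAt 𝕀 y).left_inv hz]

theorem contMDiffAt_iff_funRep {n : ℕ∞ω} (hn : n ≤ (∞ : ℕ∞ω)) {g : M → F}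
    (hz : z ∈ (extChartAt 𝕀 y).source) :
    ContMDiffAt 𝕀 𝓘(ℝ, F) n g z ↔ ContDiffAt ℝ n (funRep y g) (extChartAt 𝕀 y z) := by
  rw [← contMDiffAt_iff_contDiffAt]
  refine ⟨fun h ↦ ?_, fun h ↦ ?_⟩
  · refine ContMDiffAt.comp (I' := 𝕀) (g := g) _ ?_ (contMDiffAt_chart_symm hn
      ((extChartAt 𝕀 y).map_source hz))
    rwa [(extChartAt 𝕀 y).left_inv hz]
  · exact (h.comp z (contMDiffAt_chart hn hz)).congr_of_eventuallyEq (funRep_comp_chart g hz)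

theorem mdifferentiableAt_iff_funRep {g : M → F} (hz : z ∈ (extChartAt 𝕀 y).source) :
    MDifferentiableAt 𝕀 𝓘(ℝ, F) g z ↔ DifferentiableAt ℝ (funRep y g) (extChartAt 𝕀 y z) := by
  rw [← mdifferentiableAt_iff_differentiableAt]
  refine ⟨fun h ↦ ?_, fun h ↦ ?_⟩
  · refine MDifferentiableAt.comp (I' := 𝕀) (g := g) _ ?_ (mdifferentiableAt_chart_symm
      ((extChartAt 𝕀 y).map_source hz))
    rwa [(extChartAt 𝕀 y).left_inv hz]
  · exact (h.comp z (mdifferentiableAt_chart hz)).congr_of_eventuallyEq (funRep_comp_chart g hz)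

theorem mvfderiv_eq_fderiv_funRep {g : M → F} (hz : z ∈ (extChartAt 𝕀 y).source)
    (hg : MDifferentiableAt 𝕀 𝓘(ℝ, F) g z) (v : TangentSpace 𝕀 z) :
    mvfderiv 𝕀 g z v = fderiv ℝ (funRep y g) (extChartAt 𝕀 y z) (chartCoord y z v) := by
  have h1 := (mdifferentiableAt_iff_funRep hz).1 hg
  have h2 : HasMFDerivAt 𝕀 𝓘(ℝ, F) (funRep y g ∘ extChartAt 𝕀 y) z _ :=
    (h1.hasFDerivAt.hasMFDerivAt).comp z (mdifferentiableAt_chart hz).hasMFDerivAt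
  have h3 := (h2.congr_of_eventuallyEq (funRep_comp_chart g hz)).mfderiv
  rw [mvfderiv, h3, chartCoord_eq_mfderiv hz]
  rfl

theorem trivializationAt_snd_eq_chartCoord (Y : Π z : M, TangentSpace 𝕀 z)
    (hz : z ∈ (extChartAt 𝕀 y).source) :
    (fun x ↦ (trivializationAt E (TangentSpace 𝕀) y ⟨x, Y x⟩).2) =ᶠ[nhds z]
      fun x ↦ chartCoord y x (Y x) := by
  filter_upwards [source_mem_nhds hz] with x hx
  rw [chartCoord, Trivialization.continuousLinearMapAt_apply, Trivialization.linearMapAt_apply,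
    if_pos (mem_baseSet_of_mem_source hx)]

theorem mdifferentiableAt_iff_fieldRep {Y : Π z : M, TangentSpace 𝕀 z}
    (hz : z ∈ (extChartAt 𝕀 y).source) :
    MDiffAt (T% Y) z ↔ DifferentiableAt ℝ (fieldRep y Y) (extChartAt 𝕀 y z) := by
  rw [Trivialization.mdifferentiableAt_section_iff 𝕀 (trivializationAt E (TangentSpace 𝕀) y) Y
    (mem_baseSet_of_mem_source hz), (trivializationAt_snd_eq_chartCoord Y hz).mdifferentiableAt_iff,
    mdifferentiableAt_iff_funRep hz]
  rfl

theorem contMDiffAt_iff_fieldRep {n : ℕ∞ω} (hn : n + 1 ≤ (∞ : ℕ∞ω)) {Y : Π z : M, TangentSpace 𝕀 z}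
    (hz : z ∈ (extChartAt 𝕀 y).source) :
    CMDiffAt n (T% Y) z ↔ ContDiffAt ℝ n (fieldRep y Y) (extChartAt 𝕀 y z) := by
  have hn' : n ≤ (∞ : ℕ∞ω) := le_self_add.trans hn
  have : IsManifold 𝕀 (n + 1) M := .of_le hn
  have : ContMDiffVectorBundle n E (TangentSpace 𝕀 : M → Type _) 𝕀 :=
    TangentBundle.contMDiffVectorBundle
  rw [Trivialization.contMDiffAt_section_iff (trivializationAt E (TangentSpace 𝕀) y)
    (mem_baseSet_of_mem_source hz), (trivializationAt_snd_eq_chartCoord Y hz).contMDiffAt_iff,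
    contMDiffAt_iff_funRep hn' hz]
  rfl

theorem fieldRep_chart (Y : Π z : M, TangentSpace 𝕀 z) (hz : z ∈ (extChartAt 𝕀 y).source) :
    fieldRep y Y (extChartAt 𝕀 y z) = chartCoord y z (Y z) :=
  funRep_chart (fun z ↦ chartCoord y z (Y z)) hz

/-- The vector field with constant coordinates `a` in the chart at `y`. -/
def coordField (y : M) (a : E) (z : M) : TangentSpace 𝕀 z := coordVec y z a

theorem fieldRep_coordField (a : E) {p : E} (hp : p ∈ (extChartAt 𝕀 y).target) :
    fieldRep y (coordField y a) p = a :=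
  chartCoord_coordVec ((extChartAt 𝕀 y).map_target hp) a

theorem fieldRep_coordField_eventuallyEq (a : E) {p : E} (hp : p ∈ (extChartAt 𝕀 y).target) :
    fieldRep y (coordField y a) =ᶠ[nhds p] fun _ ↦ a := by
  filter_upwards [target_mem_nhds hp] with q hq using fieldRep_coordField a hq

theorem mdifferentiableAt_coordField (a : E) (hz : z ∈ (extChartAt 𝕀 y).source) :
    MDiffAt (T% (coordField y a)) z := by
  rw [mdifferentiableAt_iff_fieldRep hz]
  exact (differentiableAt_const a).congr_of_eventuallyEq
    (fieldRep_coordField_eventuallyEq a ((extChartAt 𝕀 y).map_source hz))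

theorem contMDiffAt_coordField {n : ℕ∞ω} (hn : n + 1 ≤ (∞ : ℕ∞ω)) (a : E)
    (hz : z ∈ (extChartAt 𝕀 y).source) :
    CMDiffAt n (T% (coordField y a)) z := by
  rw [contMDiffAt_iff_fieldRep hn hz]
  exact contDiffAt_const.congr_of_eventuallyEq
    (fieldRep_coordField_eventuallyEq a ((extChartAt 𝕀 y).map_source hz))

/-- The constant vector field on the model space. -/
def constField (a : E) (p : E) : TangentSpace 𝓘(ℝ, E) p := a

theorem mdifferentiableAt_constField (a : E) (p : E) : MDiffAt (T% (constField a)) p := by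
  rw [mdifferentiableAt_iff_fieldRep (mem_extChartAt_source p)]
  refine (differentiableAt_const a).congr_of_eventuallyEq (Filter.Eventually.of_forall fun q ↦ ?_)
  simp only [fieldRep, chartCoord, constField, TangentBundle.continuousLinearMapAt_model_space]
  rfl

theorem mlieBracket_constField (a b p : E) :
    mlieBracket 𝓘(ℝ, E) (constField a) (constField b) p = 0 := by
  rw [← mlieBracketWithin_univ, mlieBracketWithin_eq_lieBracketWithin]
  change lieBracketWithin ℝ (fun _ : E ↦ a) (fun _ : E ↦ b) Set.univ p = 0
  simp [lieBracket]

/-- Near `z`, coordinate fields are pullbacks of constant fields under the chart, and the bracket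
commutes with pullback. -/
theorem mlieBracket_coordField [CompleteSpace E] (a b : E) (hz : z ∈ (extChartAt 𝕀 y).source) :
    mlieBracket 𝕀 (coordField y a) (coordField y b) z = 0 := by
  have hM : IsManifold 𝕀 (minSmoothness ℝ 2) M := .of_le (n := (∞ : ℕ∞ω)) (by
    rw [minSmoothness_of_isRCLikeNormedField]; exact two_le_infty)
  have h : ∀ a : E, mpullback 𝕀 𝓘(ℝ, E) (extChartAt 𝕀 y) (constField a) =ᶠ[nhds z]
      coordField y a := by
    intro a
    filter_upwards [source_mem_nhds hz] with w hw
    have hinv : (chartCoord y w : TangentSpace 𝕀 w →L[ℝ] E).inverse = coordVec y w :=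
      ContinuousLinearMap.inverse_eq
        (ContinuousLinearMap.ext fun a ↦ chartCoord_coordVec hw a)
        (ContinuousLinearMap.ext fun a ↦ coordVec_chartCoord hw a)
    rw [chartCoord_eq_mfderiv hw] at hinv
    exact congrArg (fun B : E →L[ℝ] TangentSpace 𝕀 w ↦ B a) hinv
  rw [← (h a).mlieBracket_vectorField_eq (h b),
    ← mpullback_mlieBracket (n := (∞ : ℕ∞ω)) (x₀ := z) (mdifferentiableAt_constField a _)
      (mdifferentiableAt_constField b _) (contMDiffAt_chart le_rfl hz) (by
        rw [minSmoothness_of_isRCLikeNormedField]; exact two_le_infty),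
    mpullback_apply, mlieBracket_constField, map_zero]

end Chart

/-! ### The metric and the connection in a chart -/

section Metric

variable {E : Type*} [NormedAddCommGroup E] [NormedSpace ℝ E] [FiniteDimensional ℝ E]
  [CompleteSpace E]
  {M : Type*} [TopologicalSpace M] [ChartedSpace E M] [IsManifold 𝓘(ℝ, E) ∞ M]
  [RiemannianBundle (fun x : M ↦ TangentSpace 𝓘(ℝ, E) x)]
  [IsContMDiffRiemannianBundle 𝓘(ℝ, E) ∞ E (fun x : M ↦ TangentSpace 𝓘(ℝ, E) x)]

local notation "𝕀" => 𝓘(ℝ, E)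

variable {y z : M}

theorem contDiffAt_clm_of_apply {F G : Type*} [NormedAddCommGroup F] [NormedSpace ℝ F]
    [NormedAddCommGroup G] [NormedSpace ℝ G] {n : ℕ∞ω} {A : F → E →L[ℝ] G} {x : F}
    (h : ∀ a, ContDiffAt ℝ n (fun p ↦ A p a) x) : ContDiffAt ℝ n A x := by
  let b := Module.finBasis ℝ E
  have key : A = fun p ↦ ∑ i, (ContinuousLinearMap.smulRightL ℝ E G
      (LinearMap.toContinuousLinearMap (b.coord i))) (A p (b i)) := by
    ext p x
    conv_lhs => rw [← b.sum_repr x]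
    simp only [map_sum, map_smul, sum_apply]
    rfl
  rw [key]
  exact ContDiffAt.sum fun i _ ↦ (ContinuousLinearMap.contDiff _).contDiffAt.comp x (h (b i))

/-! ### The metric in a chart -/

/-- The Riemannian metric in the chart at `y`. -/
def metricRep (y : M) (p : E) : E →L[ℝ] E →L[ℝ] ℝ :=
  (innerSL ℝ (E := TangentSpace 𝕀 ((extChartAt 𝕀 y).symm p))).bilinearComp
    (coordVec y ((extChartAt 𝕀 y).symm p)) (coordVec y ((extChartAt 𝕀 y).symm p))

theorem metricRep_apply (p a b : E) :
    metricRep y p a b = inner ℝ (coordField y a ((extChartAt 𝕀 y).symm p))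
      (coordField y b ((extChartAt 𝕀 y).symm p)) := rfl

theorem metricRep_chart (hz : z ∈ (extChartAt 𝕀 y).source) (v w : TangentSpace 𝕀 z) :
    metricRep y (extChartAt 𝕀 y z) (chartCoord y z v) (chartCoord y z w) = inner ℝ v w := by
  rw [metricRep_apply, (extChartAt 𝕀 y).left_inv hz, coordField, coordField,
    coordVec_chartCoord hz, coordVec_chartCoord hz]

theorem metricRep_eq_funRep (a b : E) :
    (fun p ↦ metricRep y p a b) =
      funRep y (fun z ↦ inner ℝ (coordField y a z) (coordField y b z)) := rfl

theorem contDiffAt_metricRep {n : ℕ∞ω} (hn : n + 1 ≤ (∞ : ℕ∞ω)) {p : E}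
    (hp : p ∈ (extChartAt 𝕀 y).target) : ContDiffAt ℝ n (metricRep (M := M) y) p := by
  have hn' : n ≤ (∞ : ℕ∞ω) := le_self_add.trans hn
  have : IsContMDiffRiemannianBundle 𝕀 n E (fun x : M ↦ TangentSpace 𝕀 x) := .of_le hn'
  refine contDiffAt_clm_of_apply fun a ↦ contDiffAt_clm_of_apply fun b ↦ ?_
  have hz := (extChartAt 𝕀 y).map_target hp
  rw [metricRep_eq_funRep, ← (extChartAt 𝕀 y).right_inv hp, ← contMDiffAt_iff_funRep hn' hz]
  exact ContMDiffAt.inner_bundle (contMDiffAt_coordField hn a hz)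
    (contMDiffAt_coordField hn b hz)

theorem metricRep_pos {p : E} (hp : p ∈ (extChartAt 𝕀 y).target) {a : E}
    (h : metricRep (M := M) y p a a = 0) : a = 0 := by
  have h2 : coordField y a ((extChartAt 𝕀 y).symm p) = 0 := by
    rw [metricRep_apply] at h
    exact inner_self_eq_zero.1 h
  rw [← chartCoord_coordVec ((extChartAt 𝕀 y).map_target hp) a]
  rw [coordField] at h2
  rw [h2, map_zero]

/-- The metric in a chart, as an isomorphism between the model space and its dual. -/
theorem exists_equiv_metricRep {p : E} (hp : p ∈ (extChartAt 𝕀 y).target) :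
    ∃ e : E ≃L[ℝ] (E →L[ℝ] ℝ), (e : E →L[ℝ] (E →L[ℝ] ℝ)) = metricRep (M := M) y p := by
  have hinj : Function.Injective (metricRep (M := M) y p : E →ₗ[ℝ] (E →L[ℝ] ℝ)) := by
    rw [← LinearMap.ker_eq_bot, LinearMap.ker_eq_bot']
    intro a ha
    exact metricRep_pos hp (congrArg (fun f : E →L[ℝ] ℝ ↦ f a) ha)
  have hdim : Module.finrank ℝ E = Module.finrank ℝ (E →L[ℝ] ℝ) := by
    rw [← (LinearMap.toContinuousLinearMap (𝕜 := ℝ) (E := E) (F' := ℝ)).finrank_eq]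
    exact Subspace.dual_finrank_eq.symm
  exact ⟨(LinearMap.linearEquivOfInjective _ hinj hdim).toContinuousLinearEquiv, by ext; rfl⟩

/-! ### Christoffel symbols -/

/-- `∇_a b` for the constant fields `a` and `b` of the chart at `y`. -/
def christoffelAux (y z : M) (a b : E) : E :=
  chartCoord y z (leviCivita 𝕀 M (coordField y b) z (coordVec y z a))

theorem christoffelAux_add_right (hz : z ∈ (extChartAt 𝕀 y).source) (a b b' : E) :
    christoffelAux y z a (b + b') = christoffelAux y z a b + christoffelAux y z a b' := by
  have h : coordField y (b + b') = coordField y b + (coordField y b' : Π z : M, _) := by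
    ext z; simp [coordField]
  simp only [christoffelAux]
  rw [h, (leviCivita 𝕀 M).isCovariantDerivativeOn.add (mdifferentiableAt_coordField b hz)
    (mdifferentiableAt_coordField b' hz)]
  simp

theorem christoffelAux_smul_right (hz : z ∈ (extChartAt 𝕀 y).source) (c : ℝ) (a b : E) :
    christoffelAux y z a (c • b) = c • christoffelAux y z a b := by
  have h : coordField y (c • b) = c • (coordField y b : Π z : M, _) := by
    ext z; simp [coordField]
  simp only [christoffelAux]
  rw [h, (leviCivita 𝕀 M).isCovariantDerivativeOn.smul_const c
    (mdifferentiableAt_coordField b hz)]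
  simp

open Classical in
/-- The Christoffel symbols of the chart at `y`. -/
def christoffel (y : M) (p : E) : E →L[ℝ] E →L[ℝ] E :=
  if hp : p ∈ (extChartAt 𝕀 y).target then
    LinearMap.toContinuousLinearMap ((LinearMap.toContinuousLinearMap :
        (E →ₗ[ℝ] E) ≃ₗ[ℝ] (E →L[ℝ] E)).toLinearMap.comp
      (LinearMap.mk₂ ℝ (christoffelAux y ((extChartAt 𝕀 y).symm p))
      (fun a a' b ↦ by simp only [christoffelAux, map_add])
      (fun c a b ↦ by simp only [christoffelAux, map_smul])
      (christoffelAux_add_right ((extChartAt 𝕀 y).map_target hp))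
      (fun c a b ↦ christoffelAux_smul_right ((extChartAt 𝕀 y).map_target hp) c a b)))
  else 0

theorem christoffel_chart (hz : z ∈ (extChartAt 𝕀 y).source) (a b : E) :
    christoffel y (extChartAt 𝕀 y z) a b = christoffelAux y z a b := by
  rw [christoffel, dif_pos ((extChartAt 𝕀 y).map_source hz)]
  change christoffelAux y ((extChartAt 𝕀 y).symm (extChartAt 𝕀 y z)) a b = _
  rw [(extChartAt 𝕀 y).left_inv hz]

theorem leviCivita_coordField (hz : z ∈ (extChartAt 𝕀 y).source) (a b : E) :
    leviCivita 𝕀 M (coordField y b) z (coordVec y z a) =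
      coordVec y z (christoffel y (extChartAt 𝕀 y z) a b) := by
  rw [christoffel_chart hz, christoffelAux, coordVec_chartCoord hz]

theorem fieldRep_smul (f : M → ℝ) (Y : Π z : M, TangentSpace 𝕀 z) :
    fieldRep y (f • Y) = fun p ↦ funRep y f p • fieldRep y Y p := by
  ext p; exact map_smul (chartCoord y ((extChartAt 𝕀 y).symm p)) _ _

theorem fieldRep_add (Y Y' : Π z : M, TangentSpace 𝕀 z) :
    fieldRep y (Y + Y') = fun p ↦ fieldRep y Y p + fieldRep y Y' p := by
  ext p; exact map_add (chartCoord y ((extChartAt 𝕀 y).symm p)) _ _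

/-- The Levi-Civita connection in a chart. -/
theorem chartCoord_leviCivita {Y : Π z : M, TangentSpace 𝕀 z}
    (hz : z ∈ (extChartAt 𝕀 y).source) (hY : MDiffAt (T% Y) z) (v : TangentSpace 𝕀 z) :
    chartCoord y z (leviCivita 𝕀 M Y z v) =
      fderiv ℝ (fieldRep y Y) (extChartAt 𝕀 y z) (chartCoord y z v) +
        christoffel y (extChartAt 𝕀 y z) (chartCoord y z v) (chartCoord y z (Y z)) := by
  -- The Leibniz terms of the connection and of the coordinate derivative cancel. The difference
  -- thus depends only on `Y z`, and may be computed on the coordinate field with that value.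
  have hT : TensorialAt 𝕀 E (fun Y : Π z : M, TangentSpace 𝕀 z ↦
      chartCoord y z (leviCivita 𝕀 M Y z v) -
      fderiv ℝ (fieldRep y Y) (extChartAt 𝕀 y z) (chartCoord y z v)) z :=
    { smul := by
        intro f Y hf hY
        have h1 := (mdifferentiableAt_iff_funRep hz).1 hf
        have h2 := (mdifferentiableAt_iff_fieldRep hz).1 hY
        rw [(leviCivita 𝕀 M).isCovariantDerivativeOn.leibniz hY hf, fieldRep_smul,
          fderiv_fun_smul h1 h2]
        simp only [add_apply, smul_apply, ContinuousLinearMap.smulRight_apply, map_add, map_smul]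
        rw [mvfderiv_eq_fderiv_funRep hz hf, funRep_chart f hz, fieldRep_chart Y hz]
        module
      add := by
        intro Y Y' hY hY'
        have h1 := (mdifferentiableAt_iff_fieldRep hz).1 hY
        have h2 := (mdifferentiableAt_iff_fieldRep hz).1 hY'
        rw [(leviCivita 𝕀 M).isCovariantDerivativeOn.add hY hY', fieldRep_add,
          fderiv_fun_add h1 h2]
        simp only [add_apply, map_add]
        module }
  have h := hT.pointwise hY (mdifferentiableAt_coordField (chartCoord y z (Y z)) hz)
    (coordVec_chartCoord hz (Y z)).symm
  rw [sub_eq_iff_eq_add'] at h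
  rw [h]
  congr 1
  conv_lhs => rw [← coordVec_chartCoord hz v]
  rw [leviCivita_coordField hz, chartCoord_coordVec hz, coordVec_chartCoord hz,
    (fieldRep_coordField_eventuallyEq _ ((extChartAt 𝕀 y).map_source hz)).fderiv_eq]
  simp

/-- Absence of torsion, applied to commuting coordinate fields. -/
theorem christoffel_symm {p : E} (hp : p ∈ (extChartAt 𝕀 y).target) (a b : E) :
    christoffel (M := M) y p a b = christoffel y p b a := by
  have hz := (extChartAt 𝕀 y).map_target hp
  set z := (extChartAt 𝕀 y).symm p with hzdef
  have hpz : p = extChartAt 𝕀 y z := ((extChartAt 𝕀 y).right_inv hp).symm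
  have h := ((leviCivita 𝕀 M).torsion_eq_zero_iff.1 leviCivita_torsion)
    (mdifferentiableAt_coordField a hz) (mdifferentiableAt_coordField b hz)
  rw [mlieBracket_coordField a b hz, sub_eq_zero] at h
  rw [hpz, christoffel_chart hz, christoffel_chart hz, christoffelAux, christoffelAux]
  exact congrArg _ h

theorem fderiv_clm_apply_apply {F G : Type*} [NormedAddCommGroup F] [NormedSpace ℝ F]
    [NormedAddCommGroup G] [NormedSpace ℝ G] {A : E → E →L[ℝ] F →L[ℝ] G} {x : E}
    (hA : DifferentiableAt ℝ A x) (a : E) (b : F) (c : E) :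
    fderiv ℝ (fun q ↦ A q a b) x c = fderiv ℝ A x c a b := by
  have h : HasFDerivAt (fun q ↦ A q a b) _ x :=
    (hA.hasFDerivAt.clm_apply (hasFDerivAt_const a x)).clm_apply (hasFDerivAt_const b x)
  rw [h.fderiv]
  simp

theorem mvfderiv_inner_coordField {p : E} (hp : p ∈ (extChartAt 𝕀 y).target) (a b c : E) :
    mvfderiv 𝕀 (fun z : M ↦ inner ℝ (coordField y a z) (coordField y b z))
      ((extChartAt 𝕀 y).symm p) (coordField y c ((extChartAt 𝕀 y).symm p)) =
      fderiv ℝ (metricRep (M := M) y) p c a b := by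
  have hz := (extChartAt 𝕀 y).map_target hp
  have hd : DifferentiableAt ℝ (metricRep (M := M) y) p :=
    (contDiffAt_metricRep (n := 1) two_le_infty hp).differentiableAt (by simp)
  rw [mvfderiv_eq_fderiv_funRep hz (mdifferentiableAt_inner (mdifferentiableAt_coordField a hz)
    (mdifferentiableAt_coordField b hz)), (extChartAt 𝕀 y).right_inv hp, ← metricRep_eq_funRep,
    coordField, chartCoord_coordVec hz]
  exact fderiv_clm_apply_apply hd a b c

/-- The Koszul formula for coordinate fields, whose brackets vanish. -/
theorem metricRep_christoffel {p : E} (hp : p ∈ (extChartAt 𝕀 y).target) (a b c : E) :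
    metricRep (M := M) y p (christoffel (M := M) y p a b) c =
      (1 / 2) * (fderiv ℝ (metricRep (M := M) y) p a b c + fderiv ℝ (metricRep (M := M) y) p b a c
        - fderiv ℝ (metricRep (M := M) y) p c a b) := by
  have hz := (extChartAt 𝕀 y).map_target hp
  have h := inner_leviCivitaFun (mdifferentiableAt_coordField a hz)
    (mdifferentiableAt_coordField b hz) (mdifferentiableAt_coordField c hz)
  rw [koszul, mlieBracket_coordField _ _ hz, mlieBracket_coordField _ _ hz,
    mlieBracket_coordField _ _ hz, mvfderiv_inner_coordField hp, mvfderiv_inner_coordField hp,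
    mvfderiv_inner_coordField hp] at h
  simp only [inner_zero_left, add_zero, sub_zero] at h
  rw [← h]
  change _ = inner ℝ (leviCivita 𝕀 M (coordField y b) _ (coordVec y _ a)) _
  rw [leviCivita_coordField hz, (extChartAt 𝕀 y).right_inv hp]
  rfl

theorem fderiv_metricRep {p : E} (hp : p ∈ (extChartAt 𝕀 y).target) (a b c : E) :
    fderiv ℝ (metricRep (M := M) y) p c a b =
      metricRep (M := M) y p (christoffel (M := M) y p c a) b +
        metricRep (M := M) y p a (christoffel (M := M) y p c b) := by
  have hz := (extChartAt 𝕀 y).map_target hp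
  have h := leviCivita_metric (mdifferentiableAt_coordField c hz)
    (mdifferentiableAt_coordField a hz) (mdifferentiableAt_coordField b hz)
  rw [mvfderiv_inner_coordField hp] at h
  rw [h]
  simp only [coordField]
  change inner ℝ (leviCivita 𝕀 M (coordField y a) _ (coordVec y _ c)) _ +
    inner ℝ _ (leviCivita 𝕀 M (coordField y b) _ (coordVec y _ c)) = _
  rw [leviCivita_coordField hz, leviCivita_coordField hz, (extChartAt 𝕀 y).right_inv hp]
  rfl

theorem contDiffAt_fderiv_apply {F G : Type*} [NormedAddCommGroup F] [NormedSpace ℝ F]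
    [NormedAddCommGroup G] [NormedSpace ℝ G] {f : F → G} {x : F} (hf : ContDiffAt ℝ 2 f x) (a : F) :
    ContDiffAt ℝ 1 (fun q ↦ fderiv ℝ f q a) x :=
  (hf.fderiv_right (m := 1) le_rfl).clm_apply contDiffAt_const

/-- The connection is defined point by point, so its regularity must be read off from a formula:
`Γ(a, b)` is the inverse of the metric applied to the covector `ℓ` of first derivatives of the
metric, and inversion is smooth at invertible maps. -/
theorem contDiffAt_christoffel {p : E} (hp : p ∈ (extChartAt 𝕀 y).target) :
    ContDiffAt ℝ 1 (christoffel (M := M) y) p := by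
  refine contDiffAt_clm_of_apply fun a ↦ contDiffAt_clm_of_apply fun b ↦ ?_
  set G : E → E →L[ℝ] E →L[ℝ] ℝ := metricRep (M := M) y
  have hG : ContDiffAt ℝ 2 G p := contDiffAt_metricRep
    (WithTop.coe_le_coe.2 (le_top : (3 : ℕ∞) ≤ ⊤)) hp
  set ℓ : E → E →L[ℝ] ℝ := fun q ↦ (1 / 2 : ℝ) • (fderiv ℝ G q a b + fderiv ℝ G q b a -
    fderiv ℝ (fun q ↦ G q a b) q)
  have hℓ : ContDiffAt ℝ 1 ℓ p := by
    have h (a b : E) : ContDiffAt ℝ 1 (fun q ↦ fderiv ℝ G q a b) p :=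
      (contDiffAt_fderiv_apply hG a).clm_apply contDiffAt_const
    have h2 : ContDiffAt ℝ 2 (fun q ↦ G q a b) p :=
      (hG.clm_apply contDiffAt_const).clm_apply contDiffAt_const
    exact ContDiffAt.const_smul (1 / 2 : ℝ) (((h a b).add (h b a)).sub (h2.fderiv_right le_rfl))
  obtain ⟨e, he⟩ := exists_equiv_metricRep hp
  have hinv : ContDiffAt ℝ 1 (fun q ↦ (G q).inverse) p := by
    have h1 : ContDiffAt ℝ 1 ContinuousLinearMap.inverse (G p) := by
      rw [show G p = e from he.symm]; exact contDiffAt_map_inverse e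
    exact h1.comp p (hG.of_le (by norm_num))
  refine (hinv.clm_apply hℓ).congr_of_eventuallyEq ?_
  filter_upwards [target_mem_nhds hp] with q hq
  have hd : DifferentiableAt ℝ G q :=
    (contDiffAt_metricRep (n := 1) two_le_infty hq).differentiableAt (by simp)
  obtain ⟨e, he⟩ := exists_equiv_metricRep hq
  have h2 : ℓ q = e (christoffel (M := M) y q a b) := by
    ext c
    have h3 : (e : E →L[ℝ] (E →L[ℝ] ℝ)) (christoffel (M := M) y q a b) c =
      G q (christoffel (M := M) y q a b) c := by rw [he]
    have h5 := fderiv_clm_apply_apply hd a b c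
    refine Eq.trans ?_ (h3.trans (metricRep_christoffel hq a b c)).symm
    change (1 / 2 : ℝ) * (fderiv ℝ G q a b c + fderiv ℝ G q b a c -
      fderiv ℝ (fun q ↦ G q a b) q c) = _
    rw [h5]
  have h4 : (G q).inverse = e.symm := by
    change (metricRep (M := M) y q).inverse = _
    rw [← he, ContinuousLinearMap.inverse_equiv]
  change _ = (G q).inverse (ℓ q)
  rw [h4, h2]
  simp

end Metric

/-! ### Second derivatives and curvature in a chart -/

section Tensors

variable {E : Type*} [NormedAddCommGroup E] [NormedSpace ℝ E] [FiniteDimensional ℝ E]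
  [CompleteSpace E]
  {M : Type*} [TopologicalSpace M] [ChartedSpace E M] [IsManifold 𝓘(ℝ, E) ∞ M]
  [RiemannianBundle (fun x : M ↦ TangentSpace 𝓘(ℝ, E) x)]
  [IsContMDiffRiemannianBundle 𝓘(ℝ, E) ∞ E (fun x : M ↦ TangentSpace 𝓘(ℝ, E) x)]

local notation "𝕀" => 𝓘(ℝ, E)

variable {y z : M}

/-! ### Second derivatives and curvature in a chart -/

theorem contMDiffAt_eventually {F : Type*} [NormedAddCommGroup F] [NormedSpace ℝ F] {g : M → F}
    (hg : ContMDiffAt 𝕀 𝓘(ℝ, F) 2 g z) : ∀ᶠ x in nhds z, ContMDiffAt 𝕀 𝓘(ℝ, F) 2 g x := by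
  have : IsManifold 𝕀 2 M := .of_le two_le_infty
  exact (contMDiffAt_iff_contMDiffAt_nhds (by simp)).1 hg

/-- The second covariant derivative of a function in a chart. -/
theorem secondDeriv_eq {g : M → ℝ} (hz : z ∈ (extChartAt 𝕀 y).source)
    (hg : ContMDiffAt 𝕀 𝓘(ℝ, ℝ) 2 g z) (v w : TangentSpace 𝕀 z) :
    secondDeriv g z v w =
      fderiv ℝ (fderiv ℝ (funRep y g)) (extChartAt 𝕀 y z) (chartCoord y z v) (chartCoord y z w) -
      fderiv ℝ (funRep y g) (extChartAt 𝕀 y z)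
        (christoffel y (extChartAt 𝕀 y z) (chartCoord y z v) (chartCoord y z w)) := by
  -- The point `z` need not be the centre `y` of the chart, so `W` need not have constant
  -- coordinates. Its derivative appears in both terms of `secondDeriv` and cancels.
  set W : Π z : M, TangentSpace 𝕀 z := extend E w with hW
  have hWz : W z = w := extend_apply_self (F := E) (E := fun z : M ↦ TangentSpace 𝕀 z) w
  have hWd : MDiffAt (T% W) z := mdifferentiableAt_extend ..
  have hWr := (mdifferentiableAt_iff_fieldRep hz).1 hWd
  have hgr : ContDiffAt ℝ 2 (funRep y g) (extChartAt 𝕀 y z) :=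
    (contMDiffAt_iff_funRep two_le_infty hz).1 hg
  have hg' : ∀ᶠ x in nhds z, MDifferentiableAt 𝕀 𝓘(ℝ, ℝ) g x ∧ x ∈ (extChartAt 𝕀 y).source := by
    filter_upwards [contMDiffAt_eventually hg, source_mem_nhds hz] with x hx hx2
    exact ⟨hx.mdifferentiableAt (by simp), hx2⟩
  have hcont : ContinuousAt (extChartAt 𝕀 y).symm (extChartAt 𝕀 y z) :=
    (mdifferentiableAt_chart_symm ((extChartAt 𝕀 y).map_source hz)).continuousAt
  have hrep : funRep y (fun x ↦ mvfderiv 𝕀 g x (W x)) =ᶠ[nhds (extChartAt 𝕀 y z)]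
      fun p ↦ fderiv ℝ (funRep y g) p (fieldRep y W p) := by
    rw [← (extChartAt 𝕀 y).left_inv hz] at hg'
    filter_upwards [hcont.eventually hg', target_mem_nhds ((extChartAt 𝕀 y).map_source hz)]
      with p hp hp2
    rw [funRep, mvfderiv_eq_fderiv_funRep hp.2 hp.1, (extChartAt 𝕀 y).right_inv hp2]
    rfl
  have hD : HasFDerivAt (fun p ↦ fderiv ℝ (funRep y g) p (fieldRep y W p)) _
      (extChartAt 𝕀 y z) :=
    ((hgr.fderiv_right (m := 1) le_rfl).differentiableAt (by simp)).hasFDerivAt.clm_apply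
      hWr.hasFDerivAt
  have hmd : MDifferentiableAt 𝕀 𝓘(ℝ, ℝ) (fun x ↦ mvfderiv 𝕀 g x (W x)) z := by
    rw [mdifferentiableAt_iff_funRep hz]
    exact hD.differentiableAt.congr_of_eventuallyEq hrep
  rw [secondDeriv, ← hW, mvfderiv_eq_fderiv_funRep hz hmd, hrep.fderiv_eq, hD.fderiv,
    mvfderiv_eq_fderiv_funRep hz hg'.self_of_nhds.1, chartCoord_leviCivita hz hWd, hWz,
    fieldRep_chart W hz, hWz]
  simp only [add_apply, ContinuousLinearMap.comp_apply, ContinuousLinearMap.flip_apply, map_add]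
  ring

theorem fieldRep_extend_eventuallyEq (w : TangentSpace 𝕀 y) :
    fieldRep y (extend E w : Π z : M, TangentSpace 𝕀 z) =ᶠ[nhds (extChartAt 𝕀 y y)]
      fun _ ↦ chartCoord y y w := by
  filter_upwards [target_mem_nhds (mem_extChartAt_target y)] with p hp
  have hz := (extChartAt 𝕀 y).map_target hp
  rw [fieldRep, extend_eq_coordVec w hz, chartCoord_coordVec hz]

theorem mdifferentiableAt_extend_near (w : TangentSpace 𝕀 y)
    (hz : z ∈ (extChartAt 𝕀 y).source) :
    MDiffAt (T% (extend E w : Π z : M, TangentSpace 𝕀 z)) z := by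
  rw [mdifferentiableAt_iff_fieldRep hz]
  refine (differentiableAt_const (chartCoord y y w)).congr_of_eventuallyEq ?_
  filter_upwards [target_mem_nhds ((extChartAt 𝕀 y).map_source hz)] with p hp
  have hz := (extChartAt 𝕀 y).map_target hp
  rw [fieldRep, extend_eq_coordVec w hz, chartCoord_coordVec hz]

theorem chartCoord_leviCivita_extend (v w : TangentSpace 𝕀 y) :
    chartCoord y y (leviCivita 𝕀 M (extend E w) y v) =
      christoffel y (extChartAt 𝕀 y y) (chartCoord y y v) (chartCoord y y w) := by
  rw [chartCoord_leviCivita (mem_extChartAt_source y) (mdifferentiableAt_extend ..),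
    (fieldRep_extend_eventuallyEq w).fderiv_eq, extend_apply_self]
  simp

theorem fieldRep_leviCivita {Y W : Π z : M, TangentSpace 𝕀 z}
    {p : E} (hp : p ∈ (extChartAt 𝕀 y).target)
    (hY : MDiffAt (T% Y) ((extChartAt 𝕀 y).symm p)) :
    fieldRep y (fun x ↦ leviCivita 𝕀 M Y x (W x)) p =
      fderiv ℝ (fieldRep y Y) p (fieldRep y W p) +
        christoffel y p (fieldRep y W p) (fieldRep y Y p) := by
  rw [fieldRep, chartCoord_leviCivita ((extChartAt 𝕀 y).map_target hp) hY,
    (extChartAt 𝕀 y).right_inv hp]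
  rfl

theorem differentiableAt_christoffel {p : E} (hp : p ∈ (extChartAt 𝕀 y).target) :
    DifferentiableAt ℝ (christoffel (M := M) y) p :=
  (contDiffAt_christoffel hp).differentiableAt (by simp)

theorem hasFDerivAt_fderiv_add_bilin {f : E → E} {Γ : E → E →L[ℝ] E →L[ℝ] E} {p : E}
    (hf : ContDiffAt ℝ 2 f p) (hΓ : DifferentiableAt ℝ Γ p) (b : E) :
    DifferentiableAt ℝ (fun q ↦ fderiv ℝ f q b + Γ q b (f q)) p ∧ ∀ a,
      fderiv ℝ (fun q ↦ fderiv ℝ f q b + Γ q b (f q)) p a = fderiv ℝ (fderiv ℝ f) p a b +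
        fderiv ℝ Γ p a b (f p) + Γ p b (fderiv ℝ f p a) := by
  have h1 := ((hf.fderiv_right (m := 1) le_rfl).differentiableAt (by simp)).hasFDerivAt.clm_apply
    (hasFDerivAt_const b p)
  have h0 := hΓ.hasFDerivAt.clm_apply (hasFDerivAt_const b p)
  have h2 := h0.differentiableAt.hasFDerivAt.clm_apply (hf.differentiableAt (by simp)).hasFDerivAt
  refine ⟨h1.differentiableAt.add h2.differentiableAt, fun a ↦ ?_⟩
  rw [fderiv_fun_add h1.differentiableAt h2.differentiableAt, h1.fderiv, h2.fderiv, h0.fderiv]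
  simp only [add_apply, ContinuousLinearMap.comp_apply, ContinuousLinearMap.flip_apply, map_zero,
    zero_apply, zero_add]
  abel

/-- The second covariant derivative of a vector field in the chart at the base point. -/
theorem chartCoord_secondCovDeriv {V : Π z : M, TangentSpace 𝕀 z}
    (hV : CMDiffAt 2 (T% V) y) (v w : TangentSpace 𝕀 y) :
    let p := extChartAt 𝕀 y y
    let f := fieldRep y V
    let Γ := christoffel (M := M) y
    let a := chartCoord y y v
    let b := chartCoord y y w
    chartCoord y y (secondCovDeriv V y v w) =
      fderiv ℝ (fderiv ℝ f) p a b + fderiv ℝ Γ p a b (f p) + Γ p b (fderiv ℝ f p a) +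
      Γ p a (fderiv ℝ f p b) + Γ p a (Γ p b (f p)) - fderiv ℝ f p (Γ p a b)
      - Γ p (Γ p a b) (f p) := by
  intro p f Γ a b
  have hy := mem_extChartAt_source (I := 𝕀) y
  have hp := mem_extChartAt_target (I := 𝕀) y
  have hf : ContDiffAt ℝ 2 f p :=
    (contMDiffAt_iff_fieldRep (WithTop.coe_le_coe.2 (le_top : (3 : ℕ∞) ≤ ⊤)) hy).1 hV
  have hfd : ∀ᶠ q in nhds p, DifferentiableAt ℝ f q := by
    filter_upwards [hf.eventually (by simp)] with q hq using hq.differentiableAt (by simp)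
  have hrep : fieldRep y (fun x ↦ leviCivita 𝕀 M V x (extend E w x)) =ᶠ[nhds p]
      fun q ↦ fderiv ℝ f q b + Γ q b (f q) := by
    filter_upwards [target_mem_nhds hp, fieldRep_extend_eventuallyEq w, hfd] with q hq hq2 hq3
    have hz := (extChartAt 𝕀 y).map_target hq
    rw [fieldRep_leviCivita hq, hq2]
    rw [mdifferentiableAt_iff_fieldRep hz, (extChartAt 𝕀 y).right_inv hq]
    exact hq3
  obtain ⟨h3, h4⟩ := hasFDerivAt_fderiv_add_bilin hf (differentiableAt_christoffel hp) b
  have hmd : MDiffAt (T% (fun x ↦ leviCivita 𝕀 M V x (extend E w x))) y := by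
    rw [mdifferentiableAt_iff_fieldRep hy]
    exact h3.congr_of_eventuallyEq hrep
  have hVd : MDiffAt (T% V) y := (mdifferentiableAt_iff_fieldRep hy).2 hfd.self_of_nhds
  have h5 : chartCoord y y (leviCivita 𝕀 M V y (extend E w y)) = fderiv ℝ f p b + Γ p b (f p) :=
    (fieldRep_chart _ hy).symm.trans hrep.self_of_nhds
  have h6 := chartCoord_leviCivita hy hmd v
  rw [hrep.fderiv_eq, h4, h5] at h6
  have h7 := chartCoord_leviCivita hy hVd (leviCivita 𝕀 M (extend E w) y v)
  rw [chartCoord_leviCivita_extend, ← fieldRep_chart V hy] at h7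
  rw [secondCovDeriv, map_sub, h6, h7, map_add]
  abel

/-- The curvature tensor in the chart at the base point. -/
theorem chartCoord_curvature (u v w : TangentSpace 𝕀 y) :
    let p := extChartAt 𝕀 y y
    let Γ := christoffel (M := M) y
    let a := chartCoord y y u
    let b := chartCoord y y v
    let c := chartCoord y y w
    chartCoord y y (curvature y u v w) =
      fderiv ℝ Γ p a b c + Γ p a (Γ p b c) - fderiv ℝ Γ p b a c - Γ p b (Γ p a c) := by
  intro p Γ a b c
  have hy := mem_extChartAt_source (I := 𝕀) y
  have hp := mem_extChartAt_target (I := 𝕀) y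
  have key : ∀ u v : TangentSpace 𝕀 y,
      chartCoord y y (leviCivita 𝕀 M (fun x ↦ leviCivita 𝕀 M (extend E w) x (extend E v x)) y
        (extend E u y)) = fderiv ℝ Γ p (chartCoord y y u) (chartCoord y y v) c +
          Γ p (chartCoord y y u) (Γ p (chartCoord y y v) c) := by
    intro u v
    have hrep : fieldRep y (fun x ↦ leviCivita 𝕀 M (extend E w) x (extend E v x)) =ᶠ[nhds p]
        fun q ↦ Γ q (chartCoord y y v) c := by
      filter_upwards [target_mem_nhds hp, fieldRep_extend_eventuallyEq w,
        (fieldRep_extend_eventuallyEq w).eventually_nhds,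
        fieldRep_extend_eventuallyEq v] with q hq hq2 hq4 hq3
      have hz := (extChartAt 𝕀 y).map_target hq
      rw [fieldRep_leviCivita hq (mdifferentiableAt_extend_near w hz), hq2, hq3,
        Filter.EventuallyEq.fderiv_eq hq4]
      simp [Γ, c]
    have hd := differentiableAt_christoffel (M := M) hp
    have h2 : DifferentiableAt ℝ (fun q ↦ Γ q (chartCoord y y v) c) p :=
      (hd.clm_apply (differentiableAt_const _)).clm_apply (differentiableAt_const _)
    have hmd : MDiffAt (T% (fun x ↦ leviCivita 𝕀 M (extend E w) x
        ((extend E v : Π z : M, TangentSpace 𝕀 z) x))) y := by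
      rw [mdifferentiableAt_iff_fieldRep hy]
      exact h2.congr_of_eventuallyEq hrep
    have h5 : chartCoord y y (leviCivita 𝕀 M (extend E w) y (extend E v y)) =
      Γ p (chartCoord y y v) c := (fieldRep_chart _ hy).symm.trans hrep.self_of_nhds
    rw [chartCoord_leviCivita hy hmd, hrep.fderiv_eq, extend_apply_self,
      fderiv_clm_apply_apply hd, h5]
  have hext : ∀ u : TangentSpace 𝕀 y, (extend E u : Π z : M, TangentSpace 𝕀 z) =ᶠ[nhds y]
      coordField y (chartCoord y y u) := by
    intro u
    filter_upwards [source_mem_nhds hy] with z hz using extend_eq_coordVec u hz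
  rw [curvature, curvatureField, map_sub, map_sub, key, key,
    (hext u).mlieBracket_vectorField_eq (hext v), mlieBracket_coordField _ _ hy, map_zero,
    map_zero]
  simp only [a, b]
  abel

end Tensors

/-! ### Homogeneity and bounds -/

/-- The norms of the theorem are suprema over unit vectors; homogeneity, without additivity,
suffices to pass to all vectors. -/
theorem norm_le_of_unit_of_homogeneous {T F : Type*} [NormedAddCommGroup T] [NormedSpace ℝ T]
    [NormedAddCommGroup F] [NormedSpace ℝ F] {Q : T → T → F} {A : ℝ}
    (hQ : ∀ (c d : ℝ) v w, Q (c • v) (d • w) = (c * d) • Q v w)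
    (h : ∀ v w, ‖v‖ = 1 → ‖w‖ = 1 → ‖Q v w‖ ≤ A) (v w : T) : ‖Q v w‖ ≤ A * ‖v‖ * ‖w‖ := by
  by_cases hv : v = 0
  · have := hQ 0 1 v w
    simp only [zero_smul, one_smul, zero_mul] at this
    simp [hv, this]
  by_cases hw : w = 0
  · have := hQ 1 0 v w
    simp only [zero_smul, one_smul, mul_zero] at this
    simp [hw, this]
  have hv' : ‖v‖ ≠ 0 := norm_ne_zero_iff.2 hv
  have hw' : ‖w‖ ≠ 0 := norm_ne_zero_iff.2 hw
  have h1 := h (‖v‖⁻¹ • v) (‖w‖⁻¹ • w) (by simp [norm_smul, hv']) (by simp [norm_smul, hw'])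
  have h2 : Q v w = (‖v‖ * ‖w‖) • Q (‖v‖⁻¹ • v) (‖w‖⁻¹ • w) := by
    rw [hQ, smul_smul]
    field_simp
    simp
  rw [h2, norm_smul, norm_mul, norm_norm, norm_norm]
  calc ‖v‖ * ‖w‖ * ‖Q (‖v‖⁻¹ • v) (‖w‖⁻¹ • w)‖ ≤ ‖v‖ * ‖w‖ * A := by gcongr
    _ = A * ‖v‖ * ‖w‖ := by ring

/-- The coordinate expression of `∇²V`. Homogeneity of `secondCovDeriv` is not visible from its
definition by extensions, and is obtained from the chart formula. -/
theorem secondCovDeriv_expr_smul {F : Type*} [NormedAddCommGroup F] [NormedSpace ℝ F]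
    (D G : F →L[ℝ] F →L[ℝ] F) (K : F →L[ℝ] F →L[ℝ] F →L[ℝ] F) (A : F →L[ℝ] F) (u : F) (c d : ℝ)
    (a b : F) :
    D (c • a) (d • b) + K (c • a) (d • b) u + G (d • b) (A (c • a)) + G (c • a) (A (d • b)) +
      G (c • a) (G (d • b) u) - A (G (c • a) (d • b)) - G (G (c • a) (d • b)) u =
    (c * d) • (D a b + K a b u + G b (A a) + G a (A b) + G a (G b u) - A (G a b) -
      G (G a b) u) := by
  have h : K (c • a) (d • b) = (c * d) • K a b := by
    rw [K.map_smul c a, smul_apply, (K a).map_smul d b, smul_smul]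
  rw [h]
  generalize K a b = B
  clear h K
  simp only [map_smul, smul_apply, mul_smul, smul_add, smul_sub, smul_comm d c]

theorem curvature_expr_smul {F : Type*} [NormedAddCommGroup F] [NormedSpace ℝ F]
    (G : F →L[ℝ] F →L[ℝ] F) (K : F →L[ℝ] F →L[ℝ] F →L[ℝ] F) (c d e : ℝ) (a b w : F) :
    K (c • a) (d • b) (e • w) + G (c • a) (G (d • b) (e • w)) -
      K (d • b) (c • a) (e • w) - G (d • b) (G (c • a) (e • w)) =
    (c * d * e) • (K a b w + G a (G b w) - K b a w - G b (G a w)) := by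
  have h (c d : ℝ) (a b : F) : K (c • a) (d • b) = (c * d) • K a b := by
    rw [K.map_smul c a, smul_apply, (K a).map_smul d b, smul_smul]
  rw [h, h]
  generalize K a b = B
  generalize K b a = B'
  clear h K
  simp only [map_smul, smul_apply, mul_smul, smul_add, smul_sub, smul_comm e d, smul_comm e c,
    smul_comm d c]

/-! ### The Lie derivative of the connection, and pointwise bounds from the global norms. -/

section Bounds

variable {E : Type*} [NormedAddCommGroup E] [NormedSpace ℝ E] [FiniteDimensional ℝ E]
  [CompleteSpace E]
  {M : Type*} [TopologicalSpace M] [ChartedSpace E M] [IsManifold 𝓘(ℝ, E) ∞ M]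
  [RiemannianBundle (fun x : M ↦ TangentSpace 𝓘(ℝ, E) x)]
  [IsContMDiffRiemannianBundle 𝓘(ℝ, E) ∞ E (fun x : M ↦ TangentSpace 𝓘(ℝ, E) x)]

local notation "𝕀" => 𝓘(ℝ, E)

variable {x y z : M}

/-- The inhomogeneity in the evolution of second derivatives along a flow, in a chart. -/
theorem chartCoord_secondCovDeriv_add_curvature {V : Π z : M, TangentSpace 𝕀 z}
    (hV : CMDiffAt 2 (T% V) y) (v w : TangentSpace 𝕀 y) :
    let p := extChartAt 𝕀 y y
    let f := fieldRep y V
    let Γ := christoffel (M := M) y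
    let a := chartCoord y y v
    let b := chartCoord y y w
    chartCoord y y (secondCovDeriv V y v w + curvature y (V y) v w) =
      fderiv ℝ (fderiv ℝ f) p a b + fderiv ℝ Γ p (f p) a b + Γ p (fderiv ℝ f p a) b +
      Γ p a (fderiv ℝ f p b) - fderiv ℝ f p (Γ p a b) := by
  intro p f Γ a b
  have hp := mem_extChartAt_target (I := 𝕀) y
  have h1 := chartCoord_secondCovDeriv hV v w
  have h2 := chartCoord_curvature (V y) v w
  rw [← fieldRep_chart V (mem_extChartAt_source y)] at h2
  have hd : DifferentiableAt ℝ Γ p := differentiableAt_christoffel hp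
  -- Symmetry of `Γ` near `p` passes to its derivative. The terms `∂_a Γ` of `∇²V` and of the
  -- curvature then cancel, leaving `∂_V Γ (a, b)`; the terms quadratic in `Γ` cancel as well.
  have h3 : fderiv ℝ Γ p a b (f p) = fderiv ℝ Γ p a (f p) b := by
    rw [← fderiv_clm_apply_apply hd, ← fderiv_clm_apply_apply hd]
    refine congrArg (fun B : E →L[ℝ] E ↦ B a) (Filter.EventuallyEq.fderiv_eq ?_)
    filter_upwards [target_mem_nhds hp] with q hq using christoffel_symm hq _ _
  have h4 (a b : E) : Γ p a b = Γ p b a := christoffel_symm hp a b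
  rw [map_add, h1, h2]
  change fderiv ℝ (fderiv ℝ f) p a b + fderiv ℝ Γ p a b (f p) + Γ p b (fderiv ℝ f p a) +
    Γ p a (fderiv ℝ f p b) + Γ p a (Γ p b (f p)) - fderiv ℝ f p (Γ p a b)
    - Γ p (Γ p a b) (f p) + (fderiv ℝ Γ p (f p) a b + Γ p (f p) (Γ p a b)
    - fderiv ℝ Γ p a (f p) b - Γ p a (Γ p (f p) b)) = _
  rw [h3, h4 (Γ p a b) (f p), h4 (f p) b, h4 b (fderiv ℝ f p a)]
  abel

theorem secondCovDeriv_smul_smul {V : Π z : M, TangentSpace 𝕀 z}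
    (hV : CMDiffAt 2 (T% V) x) (c d : ℝ) (v w : TangentSpace 𝕀 x) :
    secondCovDeriv V x (c • v) (d • w) = (c * d) • secondCovDeriv V x v w := by
  apply chartCoord_injective (mem_extChartAt_source x)
  have hv : chartCoord x x (c • v) = c • chartCoord x x v := (chartCoord x x).map_smul c v
  have hw : chartCoord x x (d • w) = d • chartCoord x x w := (chartCoord x x).map_smul d w
  have h := chartCoord_secondCovDeriv hV (c • v) (d • w)
  rw [hv, hw] at h
  refine h.trans ((secondCovDeriv_expr_smul _ (christoffel x _) (fderiv ℝ (christoffel (M := M) x) _)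
    _ _ c d (chartCoord x x v) (chartCoord x x w)).trans ?_)
  rw [(chartCoord x x).map_smul]
  exact congrArg (fun z ↦ (c * d) • z) (chartCoord_secondCovDeriv hV v w).symm

theorem curvature_smul_smul_smul (c d e : ℝ) (u v w : TangentSpace 𝕀 x) :
    curvature x (c • u) (d • v) (e • w) = (c * d * e) • curvature x u v w := by
  apply chartCoord_injective (mem_extChartAt_source x)
  have hu : chartCoord x x (c • u) = c • chartCoord x x u := (chartCoord x x).map_smul c u
  have hv : chartCoord x x (d • v) = d • chartCoord x x v := (chartCoord x x).map_smul d v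
  have hw : chartCoord x x (e • w) = e • chartCoord x x w := (chartCoord x x).map_smul e w
  have h := chartCoord_curvature (c • u) (d • v) (e • w)
  rw [hu, hv, hw] at h
  refine h.trans ((curvature_expr_smul (christoffel x _) (fderiv ℝ (christoffel (M := M) x) _)
    c d e (chartCoord x x u) (chartCoord x x v) (chartCoord x x w)).trans ?_)
  rw [(chartCoord x x).map_smul]
  exact congrArg (fun z ↦ (c * d * e) • z) (chartCoord_curvature u v w).symm

theorem secondDeriv_smul_smul {g : M → ℝ} (hg : ContMDiffAt 𝕀 𝓘(ℝ, ℝ) 2 g x) (c d : ℝ)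
    (v w : TangentSpace 𝕀 x) :
    secondDeriv g x (c • v) (d • w) = (c * d) • secondDeriv g x v w := by
  rw [secondDeriv_eq (mem_extChartAt_source x) hg, secondDeriv_eq (mem_extChartAt_source x) hg]
  simp only [map_smul, smul_apply, mul_smul, smul_sub, smul_comm c d]

theorem norm_le_toNNReal {F : Type*} [SeminormedAddCommGroup F] {a : F} {B : ℝ≥0∞}
    (hB : B < ⊤) (h : ‖a‖ₑ ≤ B) : ‖a‖ ≤ B.toNNReal := by
  have := ENNReal.toNNReal_mono hB.ne h
  rw [toNNReal_enorm] at this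
  exact_mod_cast this

section Fields

theorem le_normField (V : Π p : M, TangentSpace 𝕀 p) (x : M) :
    ‖V x‖ₑ ⊔ (⨆ (v : TangentSpace 𝕀 x) (_ : ‖v‖ = 1), ‖leviCivita 𝕀 M V x v‖ₑ) ⊔
      (⨆ (v : TangentSpace 𝕀 x) (w : TangentSpace 𝕀 x) (_ : ‖v‖ = 1) (_ : ‖w‖ = 1),
        ‖secondCovDeriv V x v w‖ₑ) ≤ normField V := by
  unfold normField
  exact le_iSup (fun x : M ↦ ‖V x‖ₑ ⊔
    (⨆ (v : TangentSpace 𝕀 x) (_ : ‖v‖ = 1), ‖leviCivita 𝕀 M V x v‖ₑ) ⊔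
      ⨆ (v : TangentSpace 𝕀 x) (w : TangentSpace 𝕀 x) (_ : ‖v‖ = 1) (_ : ‖w‖ = 1),
        ‖secondCovDeriv V x v w‖ₑ) x

theorem norm_le_normField {V : Π p : M, TangentSpace 𝕀 p} (hV : IsX2b V) (x : M) : ‖V x‖ ≤ ((normField V).toNNReal : ℝ) :=
  norm_le_toNNReal hV.2 (le_trans (le_sup_left.trans le_sup_left) (le_normField V x))

theorem norm_leviCivita_le {V : Π p : M, TangentSpace 𝕀 p} (hV : IsX2b V) (v : TangentSpace 𝕀 x) :
    ‖leviCivita 𝕀 M V x v‖ ≤ ((normField V).toNNReal : ℝ) * ‖v‖ := by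
  have h1 : ∀ v : TangentSpace 𝕀 x, ‖v‖ = 1 →
      ‖leviCivita 𝕀 M V x v‖ ≤ ((normField V).toNNReal : ℝ) := by
    intro v hv
    refine norm_le_toNNReal hV.2 (le_trans ?_ (le_normField V x))
    refine le_trans ?_ (le_sup_right.trans le_sup_left)
    exact le_iSup₂ (f := fun (v : TangentSpace 𝕀 x) (_ : ‖v‖ = 1) ↦ ‖leviCivita 𝕀 M V x v‖ₑ) v hv
  by_cases hv : v = 0
  · simp [hv]
  have hv' : ‖v‖ ≠ 0 := norm_ne_zero_iff.2 hv
  have h2 := h1 (‖v‖⁻¹ • v) (by simp [norm_smul, hv'])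
  rw [map_smul, norm_smul, norm_inv, norm_norm, inv_mul_le_iff₀ (by positivity)] at h2
  linarith

theorem norm_secondCovDeriv_le {V : Π p : M, TangentSpace 𝕀 p} (hV : IsX2b V) (v w : TangentSpace 𝕀 x) :
    ‖secondCovDeriv V x v w‖ ≤ ((normField V).toNNReal : ℝ) * ‖v‖ * ‖w‖ := by
  refine norm_le_of_unit_of_homogeneous (T := TangentSpace 𝕀 x)
    (F := TangentSpace 𝕀 x) (Q := secondCovDeriv V x) (secondCovDeriv_smul_smul hV.1.contMDiffAt) ?_ v w
  intro v w hv hw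
  refine norm_le_toNNReal hV.2 (le_trans ?_ (le_normField V x))
  refine le_trans ?_ le_sup_right
  refine le_trans ?_ (le_iSup₂ (f := fun (v w : TangentSpace 𝕀 x) ↦
    ⨆ (_ : ‖v‖ = 1) (_ : ‖w‖ = 1), ‖secondCovDeriv V x v w‖ₑ) v w)
  exact le_iSup₂ (f := fun (_ : ‖v‖ = 1) (_ : ‖w‖ = 1) ↦ ‖secondCovDeriv V x v w‖ₑ) hv hw

end Fields

theorem norm_curvature_le (hR : curvatureSup 𝕀 M < ⊤) (u v w : TangentSpace 𝕀 x) :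
    ‖curvature x u v w‖ ≤ (curvatureSup 𝕀 M).toNNReal * ‖u‖ * ‖v‖ * ‖w‖ := by
  -- When the denominator vanishes, the quotient in `curvatureSup` is zero and carries no
  -- information; homogeneity covers this case.
  have h0 : ‖u‖ * ‖v‖ * ‖w‖ = 0 → curvature x u v w = 0 := by
    intro h
    simp only [mul_eq_zero, norm_eq_zero] at h
    rcases h with (h | h) | h
    · simpa [h] using curvature_smul_smul_smul 0 1 1 u v w
    · simpa [h] using curvature_smul_smul_smul 1 0 1 u v w
    · simpa [h] using curvature_smul_smul_smul 1 1 0 u v w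
  by_cases h : ‖u‖ * ‖v‖ * ‖w‖ = 0
  · rw [h0 h, norm_zero]; positivity
  have hpos : 0 < ‖u‖ * ‖v‖ * ‖w‖ := lt_of_le_of_ne (by positivity) (Ne.symm h)
  have h1 : ENNReal.ofReal (‖curvature x u v w‖ / (‖u‖ * ‖v‖ * ‖w‖)) ≤ curvatureSup 𝕀 M :=
    le_iSup_of_le x (le_iSup_of_le u (le_iSup_of_le v (le_iSup_of_le w le_rfl)))
  have h2 := ENNReal.toReal_mono hR.ne h1
  rw [ENNReal.toReal_ofReal (by positivity), div_le_iff₀ hpos] at h2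
  calc _ ≤ _ := h2
    _ = _ := by rw [← ENNReal.coe_toNNReal_eq_toReal]; ring

section Functions

variable {g : M → ℝ}

theorem le_normFun (g : M → ℝ) (x : M) :
    ‖g x‖ₑ ⊔ ‖grad (I := 𝕀) g x‖ₑ ⊔
      (⨆ (v : TangentSpace 𝕀 x) (w : TangentSpace 𝕀 x) (_ : ‖v‖ = 1) (_ : ‖w‖ = 1),
        ‖secondDeriv g x v w‖ₑ) ≤ normFun 𝕀 g := by
  unfold normFun
  exact le_iSup (fun x : M ↦ ‖g x‖ₑ ⊔ ‖grad (I := 𝕀) g x‖ₑ ⊔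
    ⨆ (v : TangentSpace 𝕀 x) (w : TangentSpace 𝕀 x) (_ : ‖v‖ = 1) (_ : ‖w‖ = 1),
      ‖secondDeriv g x v w‖ₑ) x

theorem norm_grad (g : M → ℝ) (x : M) : ‖grad (I := 𝕀) g x‖ = ‖mvfderiv 𝕀 g x‖ := by
  rw [grad, LinearIsometryEquiv.norm_map]

theorem abs_le_normFun (hg : IsC2b 𝕀 g) (x : M) : |g x| ≤ (normFun 𝕀 g).toNNReal := by
  rw [← Real.norm_eq_abs]
  exact norm_le_toNNReal hg.2 (le_trans (le_sup_left.trans le_sup_left) (le_normFun g x))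

theorem abs_mvfderiv_le (hg : IsC2b 𝕀 g) (v : TangentSpace 𝕀 x) :
    |mvfderiv 𝕀 g x v| ≤ (normFun 𝕀 g).toNNReal * ‖v‖ := by
  rw [← Real.norm_eq_abs]
  refine ((mvfderiv 𝕀 g x).le_opNorm v).trans ?_
  gcongr
  rw [← norm_grad]
  exact norm_le_toNNReal hg.2 (le_trans (le_sup_right.trans le_sup_left) (le_normFun g x))

theorem abs_secondDeriv_le (hg : IsC2b 𝕀 g) (v w : TangentSpace 𝕀 x) :
    |secondDeriv g x v w| ≤ (normFun 𝕀 g).toNNReal * ‖v‖ * ‖w‖ := by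
  rw [← Real.norm_eq_abs]
  refine norm_le_of_unit_of_homogeneous (T := TangentSpace 𝕀 x)
    (F := ℝ) (Q := secondDeriv g x) (secondDeriv_smul_smul hg.1.contMDiffAt) ?_ v w
  intro v w hv hw
  refine norm_le_toNNReal hg.2 (le_trans ?_ (le_normFun g x))
  refine le_trans ?_ le_sup_right
  refine le_trans ?_ (le_iSup₂ (f := fun (v w : TangentSpace 𝕀 x) ↦
    ⨆ (_ : ‖v‖ = 1) (_ : ‖w‖ = 1), ‖secondDeriv g x v w‖ₑ) v w)
  exact le_iSup₂ (f := fun (_ : ‖v‖ = 1) (_ : ‖w‖ = 1) ↦ ‖secondDeriv g x v w‖ₑ) hv hw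

theorem enorm_le_coe {F : Type*} [SeminormedAddCommGroup F] {a : F} {C : ℝ≥0}
    (h : ‖a‖ ≤ C) : ‖a‖ₑ ≤ C := by
  rw [← ofReal_norm, ← ENNReal.ofReal_coe_nnreal]
  exact ENNReal.ofReal_le_ofReal h

theorem normFun_le {C : ℝ≥0} (h0 : ∀ x, |g x| ≤ C)
    (h1 : ∀ (x : M) (v : TangentSpace 𝕀 x), |mvfderiv 𝕀 g x v| ≤ C * ‖v‖)
    (h2 : ∀ (x : M) (v w : TangentSpace 𝕀 x), |secondDeriv g x v w| ≤ C * ‖v‖ * ‖w‖) :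
    normFun 𝕀 g ≤ C := by
  refine iSup_le fun x ↦ sup_le (sup_le (enorm_le_coe (h0 x)) (enorm_le_coe ?_)) ?_
  · rw [norm_grad]
    exact ContinuousLinearMap.opNorm_le_bound _ C.2 fun v ↦ h1 x v
  · refine iSup_le fun v ↦ iSup_le fun w ↦ iSup_le fun hv ↦ iSup_le fun hw ↦ enorm_le_coe ?_
    simpa [hv, hw] using h2 x v w

end Functions

end Bounds

/-! ### Integral curves -/

theorem smulRight_one_clm_apply {F G : Type*} [NormedAddCommGroup F] [NormedSpace ℝ F]
    [TopologicalSpace G] [AddCommGroup G] [Module ℝ G] [ContinuousSMul ℝ G]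
    (B : F →L[ℝ] G) (a : F) : (1 : ℝ →L[ℝ] ℝ).smulRight (B a) =
      B.comp (ContinuousLinearMap.toSpanSingleton ℝ a) := by
  ext
  simp

section Curves

variable {E : Type*} [NormedAddCommGroup E] [NormedSpace ℝ E]
  {M : Type*} [TopologicalSpace M] [ChartedSpace E M] [IsManifold 𝓘(ℝ, E) ∞ M]

local notation "𝕀" => 𝓘(ℝ, E)

variable {y : M}

theorem hasDerivAt_chart_comp {γ : ℝ → M} {t : ℝ} {u : TangentSpace 𝕀 (γ t)}
    (hγ : HasMFDerivAt 𝓘(ℝ, ℝ) 𝕀 γ t ((1 : ℝ →L[ℝ] ℝ).smulRight u))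
    (ht : γ t ∈ (extChartAt 𝕀 y).source) :
    HasDerivAt (fun s ↦ extChartAt 𝕀 y (γ s)) (chartCoord y (γ t) u) t := by
  have h := (mdifferentiableAt_chart (E := E) ht).hasMFDerivAt.comp t hγ
  rw [← chartCoord_eq_mfderiv ht] at h
  have h1 : HasFDerivAt (fun s ↦ extChartAt 𝕀 y (γ s))
      ((chartCoord y (γ t)).comp ((1 : ℝ →L[ℝ] ℝ).smulRight u)) t := h.hasFDerivAt
  have h2 := h1.hasDerivAt
  rwa [ContinuousLinearMap.comp_apply, ContinuousLinearMap.smulRight_apply,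
    one_apply_eq_self, one_smul] at h2

theorem mfderiv_chart_symm {p : E} (hp : p ∈ (extChartAt 𝕀 y).target) :
    mfderiv 𝓘(ℝ, E) 𝕀 (extChartAt 𝕀 y).symm p =
      coordVec (E := E) y ((extChartAt 𝕀 y).symm p) := by
  have hz : (extChartAt 𝕀 y).symm p ∈ (extChartAt 𝕀 y).source := (extChartAt 𝕀 y).map_target hp
  have h3 := (mdifferentiableAt_chart (E := E) hz).hasMFDerivAt.comp p
      (mdifferentiableAt_chart_symm hp).hasMFDerivAt
  rw [← chartCoord_eq_mfderiv hz] at h3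
  have h4 : HasFDerivAt (extChartAt 𝕀 y ∘ (extChartAt 𝕀 y).symm) (ContinuousLinearMap.id ℝ E) p :=
    (hasFDerivAt_id _).congr_of_eventuallyEq (by
      filter_upwards [target_mem_nhds hp] with p hp using (extChartAt 𝕀 y).right_inv hp)
  have h5 := hasMFDerivAt_unique h3 h4.hasMFDerivAt
  refine ContinuousLinearMap.ext fun a : E ↦ ?_
  apply chartCoord_injective hz
  exact (DFunLike.congr_fun h5 a).trans (chartCoord_coordVec hz a).symm

theorem hasMFDerivAt_chart_symm_comp {c : ℝ → E} {t : ℝ} {a : E} (hc : HasDerivAt c a t)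
    (ht : c t ∈ (extChartAt 𝕀 y).target) :
    HasMFDerivAt 𝓘(ℝ, ℝ) 𝕀 (fun s ↦ (extChartAt 𝕀 y).symm (c s)) t
      ((1 : ℝ →L[ℝ] ℝ).smulRight (coordVec y ((extChartAt 𝕀 y).symm (c t)) a)) := by
  have h := (mdifferentiableAt_chart_symm (E := E) ht).hasMFDerivAt.comp t
    hc.hasFDerivAt.hasMFDerivAt
  rw [mfderiv_chart_symm ht] at h
  have e : (1 : ℝ →L[ℝ] ℝ).smulRight (coordVec y ((extChartAt 𝕀 y).symm (c t)) a) =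
      (coordVec (E := E) y ((extChartAt 𝕀 y).symm (c t))).comp
        (ContinuousLinearMap.toSpanSingleton ℝ a) := smulRight_one_clm_apply _ a
  rw [e]
  exact h

theorem integralCurve_hasMFDerivAt {V : Π z : M, TangentSpace 𝕀 z} {γ : ℝ → M} {s : Set ℝ}
    (hs : IsOpen s) (hγ : IsMIntegralCurveOn γ V s) {t : ℝ} (ht : t ∈ s) :
    HasMFDerivAt 𝓘(ℝ, ℝ) 𝕀 γ t ((1 : ℝ →L[ℝ] ℝ).smulRight (V (γ t))) :=
  (hγ t ht).hasMFDerivAt (hs.mem_nhds ht)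

/-- An integral curve is only required to be differentiable. In a chart its derivative is `V` along
the curve, hence continuous; this makes its length available. -/
theorem integralCurve_contMDiffAt {V : Π z : M, TangentSpace 𝕀 z} {γ : ℝ → M} {s : Set ℝ}
    (hV : CMDiff 2 (T% V)) (hs : IsOpen s) (hγ : IsMIntegralCurveOn γ V s) {t : ℝ} (ht : t ∈ s) :
    ContMDiffAt 𝓘(ℝ, ℝ) 𝕀 1 γ t := by
  set y := γ t
  have hcont : ∀ r ∈ s, ContinuousAt γ r := fun r hr ↦
    (integralCurve_hasMFDerivAt hs hγ hr).continuousAt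
  have hsrc : γ ⁻¹' (extChartAt 𝕀 y).source ∈ nhds t :=
    (hcont t ht).preimage_mem_nhds (source_mem_nhds (mem_extChartAt_source y))
  obtain ⟨u, hu, huo, htu⟩ := mem_nhds_iff.1 (Filter.inter_mem hsrc (hs.mem_nhds ht))
  have hd : ∀ r ∈ u, HasDerivAt (fun s ↦ extChartAt 𝕀 y (γ s))
      (fieldRep y V (extChartAt 𝕀 y (γ r))) r := fun r hr ↦ by
    rw [fieldRep_chart V (hu hr).1]
    exact hasDerivAt_chart_comp (integralCurve_hasMFDerivAt hs hγ (hu hr).2) (hu hr).1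
  have hc : ContDiffAt ℝ 1 (fun s ↦ extChartAt 𝕀 y (γ s)) t := by
    rw [contDiffAt_one_iff]
    refine ⟨fun r ↦ (1 : ℝ →L[ℝ] ℝ).smulRight (fieldRep y V (extChartAt 𝕀 y (γ r))), u,
      huo.mem_nhds htu, ?_, fun r hr ↦ (hd r hr).hasFDerivAt⟩
    intro r hr
    refine ContinuousAt.continuousWithinAt ?_
    have h3 : (2 : ℕ∞ω) + 1 ≤ (∞ : ℕ∞ω) := by
      have : (2 : ℕ∞ω) + 1 = ((3 : ℕ∞) : ℕ∞ω) := by norm_cast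
      rw [this]
      exact WithTop.coe_le_coe.2 le_top
    have h1 : ContinuousAt (fieldRep y V) (extChartAt 𝕀 y (γ r)) :=
      ((contMDiffAt_iff_fieldRep h3 (hu hr).1).1 (hV (γ r))).continuousAt
    have h2 := ContinuousAt.comp (f := fun s ↦ extChartAt 𝕀 y (γ s)) h1 (hd r hr).continuousAt
    exact (((ContinuousLinearMap.smulRightL ℝ ℝ E) (1 : ℝ →L[ℝ] ℝ)).continuous.continuousAt).comp h2
  have h := (contMDiffAt_chart_symm (n := 1) (by simp)
    (mem_extChartAt_target (I := 𝕀) y)).comp t hc.contMDiffAt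
  refine h.congr_of_eventuallyEq ?_
  filter_upwards [hsrc] with r hr
  exact ((extChartAt 𝕀 y).left_inv hr).symm

/-- One `ε` works for all `z` near `y`: this gives uniform existence times on compact sets as well
as the regularity of the global flow. -/
theorem exists_local_flow_chart [FiniteDimensional ℝ E] [CompleteSpace E]
    {V : Π z : M, TangentSpace 𝕀 z} (hV : CMDiff 2 (T% V)) (y : M) :
    ∃ ε : ℝ, 0 < ε ∧ ∃ ψ : ℝ → E → E,
      (∀ᶠ z in nhds y, z ∈ (extChartAt 𝕀 y).source ∧
        (extChartAt 𝕀 y).symm (ψ 0 (extChartAt 𝕀 y z)) = z ∧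
        IsMIntegralCurveOn (fun s ↦ (extChartAt 𝕀 y).symm (ψ s (extChartAt 𝕀 y z))) V
          (Set.Ioo (-ε) ε) ∧
        ∀ s ∈ Set.Ioo (-ε) ε, ψ s (extChartAt 𝕀 y z) ∈ (extChartAt 𝕀 y).target ∧
          HasDerivAt (fun s ↦ ψ s (extChartAt 𝕀 y z)) (fieldRep y V (ψ s (extChartAt 𝕀 y z))) s ∧
          ContDiffAt ℝ 2 (ψ s) (extChartAt 𝕀 y z)) ∧
      ψ 0 =ᶠ[nhds (extChartAt 𝕀 y y)] id ∧
      HasDerivAt (fun s ↦ fderiv ℝ (ψ s) (extChartAt 𝕀 y y))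
        (fderiv ℝ (fieldRep y V) (extChartAt 𝕀 y y)) 0 ∧
      ∀ a b, HasDerivAt (fun s ↦ fderiv ℝ (fderiv ℝ (ψ s)) (extChartAt 𝕀 y y) a b)
        (fderiv ℝ (fderiv ℝ (fieldRep y V)) (extChartAt 𝕀 y y) a b) 0 := by
  have h3 : (2 : ℕ∞ω) + 1 ≤ (∞ : ℕ∞ω) := by
    have : (2 : ℕ∞ω) + 1 = ((3 : ℕ∞) : ℕ∞ω) := by norm_cast
    rw [this]
    exact WithTop.coe_le_coe.2 le_top
  have hf := (contMDiffAt_iff_fieldRep h3 (mem_extChartAt_source y)).1 (hV y)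
  obtain ⟨ε, hε, ψ, h1, h2, h4⟩ :=
    exists_local_flow hf (target_mem_nhds (mem_extChartAt_target (I := 𝕀) y))
  refine ⟨ε, hε, ψ, ?_, h1.mono fun x hx ↦ hx.1, h2, h4⟩
  filter_upwards [(continuousAt_extChartAt (I := 𝕀) y).eventually h1,
    source_mem_nhds (mem_extChartAt_source (I := 𝕀) y)] with z hz hz'
  refine ⟨hz', ?_, ?_, hz.2⟩
  · rw [hz.1, (extChartAt 𝕀 y).left_inv hz']
  · intro s hs
    obtain ⟨hs1, hs2, hs3⟩ := hz.2 s hs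
    have h := hasMFDerivAt_chart_symm_comp hs2 hs1
    rw [fieldRep, coordVec_chartCoord ((extChartAt 𝕀 y).map_target hs1)] at h
    exact h.hasMFDerivWithinAt

end Curves

section Complete

variable {E : Type*} [NormedAddCommGroup E] [NormedSpace ℝ E] [FiniteDimensional ℝ E]
  [CompleteSpace E]
  {M : Type*} [MetricSpace M] [ChartedSpace E M] [IsManifold 𝓘(ℝ, E) ∞ M]
  [RiemannianBundle (fun x : M ↦ TangentSpace 𝓘(ℝ, E) x)]
  [IsContMDiffRiemannianBundle 𝓘(ℝ, E) ∞ E (fun x : M ↦ TangentSpace 𝓘(ℝ, E) x)]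
  [IsRiemannianManifold 𝓘(ℝ, E) M]

local notation "𝕀" => 𝓘(ℝ, E)

/-- The distance is at most the length of the curve, whose speed is `‖V‖ ≤ L`. -/
theorem edist_integralCurve_le {V : Π z : M, TangentSpace 𝕀 z} (hV : CMDiff 2 (T% V)) {L : ℝ≥0}
    (hL : ∀ z, ‖V z‖ ≤ L) {γ : ℝ → M} {s : Set ℝ} (hs : IsOpen s) (hγ : IsMIntegralCurveOn γ V s)
    {a b : ℝ} (hab : a ≤ b) (h : Set.Icc a b ⊆ s) :
    edist (γ a) (γ b) ≤ L * edist a b := by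
  rw [IsRiemannianManifold.out (I := 𝕀)]
  refine (riemannianEDist_le_pathELength (fun t ht ↦ (integralCurve_contMDiffAt hV hs hγ
    (h ht)).contMDiffWithinAt) rfl rfl hab).trans ?_
  rw [pathELength_eq_lintegral_mfderiv_Icc]
  calc _ ≤ ∫⁻ t in Set.Icc a b, (L : ℝ≥0∞) := by
        refine MeasureTheory.setLIntegral_mono measurable_const fun t ht ↦ ?_
        rw [(integralCurve_hasMFDerivAt hs hγ (h ht)).mfderiv]
        refine enorm_le_coe ?_
        change ‖((1 : ℝ →L[ℝ] ℝ).smulRight (V (γ t))) 1‖ ≤ L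
        simpa using hL (γ t)
    _ = _ := by
        rw [MeasureTheory.setLIntegral_const, Real.volume_Icc, edist_comm, edist_dist,
          Real.dist_eq, abs_of_nonneg (by linarith)]

end Complete

/-! ### Global existence of the flow -/

section Extension

open Set

variable {E : Type*} [NormedAddCommGroup E] [NormedSpace ℝ E]
  {M : Type*} [TopologicalSpace M] [ChartedSpace E M] [IsManifold 𝓘(ℝ, E) 1 M] [T2Space M]

local notation "𝕀" => 𝓘(ℝ, E)

/-- An integral curve through `x` is global if, on bounded time intervals, the time of existence
of the integral curves through its points is bounded below. -/
theorem exists_isMIntegralCurve_of_uniform_time_along {v : (x : M) → TangentSpace 𝕀 x}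
    (hv : CMDiff 1 (fun x ↦ (⟨x, v x⟩ : TangentBundle 𝕀 M))) (x : M)
    (h : ∀ B : ℝ, ∃ ε : ℝ, 0 < ε ∧ ∀ a ≤ B, ∀ γ : ℝ → M, γ 0 = x →
      IsMIntegralCurveOn γ v (Ioo (-a) a) → ∀ t ∈ insert 0 (Ioo (-a) a), ∃ γ' : ℝ → M, γ' 0 = γ t ∧
        IsMIntegralCurveOn γ' v (Ioo (-ε) ε)) :
    ∃ γ : ℝ → M, γ 0 = x ∧ IsMIntegralCurve γ v := by
  let s := { a | ∃ γ, γ 0 = x ∧ IsMIntegralCurveOn γ v (Ioo (-a) a) }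
  suffices hbdd : ¬BddAbove s by
    rw [not_bddAbove_iff] at hbdd
    rw [exists_isMIntegralCurve_iff_exists_isMIntegralCurveOn_Ioo hv]
    intro a
    obtain ⟨y, ⟨γ, hγ1, hγ2⟩, hlt⟩ := hbdd a
    exact ⟨γ, hγ1, hγ2.mono <| Ioo_subset_Ioo (neg_le_neg hlt.le) hlt.le⟩
  intro hbdd
  set asup := sSup s with hasup
  -- The bound covers every `a ∈ s` and also `a = 0`. For `a = 0` the interval is empty and the
  -- hypothesis is used at time `0`, producing a first integral curve.
  obtain ⟨ε, hε, h⟩ := h (max asup 0)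
  have hεs : ε ∈ s := by
    obtain ⟨γ', h1, h2⟩ := h 0 (le_max_right _ _) (fun _ ↦ x) rfl (by simp [IsMIntegralCurveOn]) 0
      (mem_insert _ _)
    exact ⟨γ', h1, h2⟩
  obtain ⟨a, ha, hlt⟩ := Real.add_neg_lt_sSup (⟨ε, hεs⟩ : Set.Nonempty s) (ε := - (ε / 2))
    (by linarith)
  have haB : a ≤ max asup 0 := (le_csSup hbdd ha).trans (le_max_left _ _)
  rw [← hasup, ← sub_eq_add_neg] at hlt
  have hεle : ε ≤ asup := le_csSup hbdd hεs
  obtain ⟨γ, h0, hγ⟩ := ha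
  obtain ⟨γ₁, h₁, hγ₁⟩ := h a haB γ h0 hγ (-(asup - ε / 2))
    (mem_insert_of_mem _ ⟨by linarith, by linarith⟩)
  rw [← isMIntegralCurveOn_comp_add (dt := asup - ε / 2)] at hγ₁
  obtain ⟨γ₂, h₂, hγ₂⟩ := h a haB γ h0 hγ (asup - ε / 2)
    (mem_insert_of_mem _ ⟨by linarith, by linarith⟩)
  rw [← isMIntegralCurveOn_comp_sub (dt := asup - ε / 2)] at hγ₂
  simp_rw [Set.mem_Ioo, ← sub_lt_iff_lt_add, ← lt_sub_iff_add_lt, ← Set.mem_Ioo] at hγ₁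
  simp_rw [Set.mem_Ioo, lt_sub_iff_add_lt, sub_lt_iff_lt_add, ← Set.mem_Ioo] at hγ₂
  -- Curves of lifetime `ε` restarted at the times `±(asup - ε / 2)` reach `±(asup + ε / 2)`, beyond
  -- the supremum.
  set γ_ext : ℝ → M := piecewise (Ioo (-(asup + ε / 2)) a)
    (piecewise (Ioo (-a) a) γ (γ₁ ∘ (· + (asup - ε / 2)))) (γ₂ ∘ (· - (asup - ε / 2)))
    with γ_ext_def
  have heq_ext : γ_ext 0 = x := by
    rw [γ_ext_def, piecewise, if_pos ⟨by linarith, by linarith⟩, piecewise,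
      if_pos ⟨by linarith, by linarith⟩, h0]
  suffices hext : IsMIntegralCurveOn γ_ext v (Ioo (-(asup + ε / 2)) (asup + ε / 2)) from
    (not_lt.mpr <| le_csSup hbdd ⟨γ_ext, heq_ext, hext⟩) <| lt_add_of_pos_right asup (half_pos hε)
  apply (isMIntegralCurveOn_piecewise (t₀ := asup - ε / 2) hv _ hγ₂
      ⟨⟨by linarith, hlt⟩, ⟨by linarith, by linarith⟩⟩
      (by rw [piecewise, if_pos ⟨by linarith, hlt⟩]; simp [h₂])).mono
    (Ioo_subset_Ioo_union_Ioo le_rfl (by linarith) (by linarith))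
  exact (isMIntegralCurveOn_piecewise (t₀ := -(asup - ε / 2)) hv hγ hγ₁
      ⟨⟨neg_lt_neg hlt, by linarith⟩, ⟨by linarith, by linarith⟩⟩ (by simp [h₁])).mono
    (union_comm _ _ ▸ Ioo_subset_Ioo_union_Ioo (by linarith) (by linarith) le_rfl)

end Extension

section Complete

variable {E : Type*} [NormedAddCommGroup E] [NormedSpace ℝ E] [FiniteDimensional ℝ E]
  [CompleteSpace E]
  {M : Type*} [MetricSpace M] [ChartedSpace E M] [IsManifold 𝓘(ℝ, E) ∞ M]

local notation "𝕀" => 𝓘(ℝ, E)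

theorem exists_uniform_time_of_isCompact {V : Π z : M, TangentSpace 𝕀 z} (hV : CMDiff 2 (T% V))
    {K : Set M} (hK : IsCompact K) :
    ∃ ε : ℝ, 0 < ε ∧ ∀ z ∈ K, ∃ γ : ℝ → M, γ 0 = z ∧ IsMIntegralCurveOn γ V (Set.Ioo (-ε) ε) := by
  refine hK.induction_on (p := fun K ↦ ∃ ε : ℝ, 0 < ε ∧ ∀ z ∈ K, ∃ γ : ℝ → M, γ 0 = z ∧
    IsMIntegralCurveOn γ V (Set.Ioo (-ε) ε)) ⟨1, one_pos, by simp⟩ ?_ ?_ ?_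
  · rintro s t hst ⟨ε, hε, h⟩
    exact ⟨ε, hε, fun z hz ↦ h z (hst hz)⟩
  · rintro s t ⟨ε, hε, h⟩ ⟨δ, hδ, h'⟩
    refine ⟨min ε δ, lt_min hε hδ, ?_⟩
    rintro z (hz | hz)
    · obtain ⟨γ, h0, hγ⟩ := h z hz
      exact ⟨γ, h0, hγ.mono (Set.Ioo_subset_Ioo (neg_le_neg (min_le_left _ _)) (min_le_left _ _))⟩
    · obtain ⟨γ, h0, hγ⟩ := h' z hz
      exact ⟨γ, h0, hγ.mono (Set.Ioo_subset_Ioo (neg_le_neg (min_le_right _ _)) (min_le_right _ _))⟩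
  · intro y _
    obtain ⟨ε, hε, ψ, h, -⟩ := exists_local_flow_chart hV y
    exact ⟨_, mem_nhdsWithin_of_mem_nhds h, ε, hε, fun z hz ↦ ⟨_, hz.2.1, hz.2.2.1⟩⟩

variable [RiemannianBundle (fun x : M ↦ TangentSpace 𝓘(ℝ, E) x)]
  [IsContMDiffRiemannianBundle 𝓘(ℝ, E) ∞ E (fun x : M ↦ TangentSpace 𝓘(ℝ, E) x)]
  [IsRiemannianManifold 𝓘(ℝ, E) M]

/-- The set is a Lipschitz image of a bounded set of times. Compactness of closed balls in `M` plays
no role. -/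
theorem totallyBounded_integralCurves {V : Π z : M, TangentSpace 𝕀 z} (hV : CMDiff 2 (T% V))
    {L : ℝ≥0} (hL : ∀ z, ‖V z‖ ≤ L) (x : M) (B : ℝ) :
    TotallyBounded {z | ∃ a ≤ B, ∃ γ : ℝ → M, γ 0 = x ∧ IsMIntegralCurveOn γ V (Set.Ioo (-a) a) ∧
      ∃ t ∈ Set.Ioo (-a) a, γ t = z} := by
  let D : Set ℝ := {t | ∃ a ≤ B, ∃ γ : ℝ → M, γ 0 = x ∧
    IsMIntegralCurveOn γ V (Set.Ioo (-a) a) ∧ t ∈ Set.Ioo (-a) a}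
  have hD : ∀ t : D, ∃ a ≤ B, ∃ γ : ℝ → M, γ 0 = x ∧
    IsMIntegralCurveOn γ V (Set.Ioo (-a) a) ∧ (t : ℝ) ∈ Set.Ioo (-a) a := fun t ↦ t.2
  choose a haB γ hγ0 hγ hta using hD
  have hV1 : CMDiff 1 (T% V) := hV.of_le (by norm_num)
  -- A separate curve was chosen for each time; uniqueness makes them one curve, so that two times
  -- can be compared along either choice.
  have hagree : ∀ (b : ℝ) (η : ℝ → M), η 0 = x → IsMIntegralCurveOn η V (Set.Ioo (-b) b) →
      ∀ t : D, (t : ℝ) ∈ Set.Ioo (-b) b → γ t t = η t := by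
    intro b η hη0 hη t ht
    have hmin : Set.Ioo (-(min (a t) b)) (min (a t) b) = Set.Ioo (-(a t)) (a t) ∩ Set.Ioo (-b) b := by
      rw [Set.Ioo_inter_Ioo, ← max_neg_neg]
    have htm : (t : ℝ) ∈ Set.Ioo (-(min (a t) b)) (min (a t) b) := hmin ▸ ⟨hta t, ht⟩
    have hpos : 0 < min (a t) b := by linarith [htm.1, htm.2]
    refine isMIntegralCurveOn_Ioo_eqOn_of_contMDiff_boundaryless (t₀ := 0)
      ⟨neg_lt_zero.2 hpos, hpos⟩ hV1 ((hγ t).mono ?_) (hη.mono ?_) ((hγ0 t).trans hη0.symm) htm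
    · rw [hmin]; exact Set.inter_subset_left
    · rw [hmin]; exact Set.inter_subset_right
  have hlip : LipschitzWith L (fun t : D ↦ γ t t) := by
    have key : ∀ s t : D, (s : ℝ) ≤ t → edist (γ s s) (γ t t) ≤ L * edist (s : ℝ) t := by
      intro s t hst
      have hmem : ∃ r : D, (s : ℝ) ∈ Set.Ioo (-(a r)) (a r) ∧ (t : ℝ) ∈ Set.Ioo (-(a r)) (a r) := by
        rcases le_total (a s) (a t) with h | h
        · exact ⟨t, ⟨by linarith [(hta s).1], by linarith [(hta s).2]⟩, hta t⟩
        · exact ⟨s, hta s, ⟨by linarith [(hta t).1], by linarith [(hta t).2]⟩⟩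
      obtain ⟨r, hs, ht⟩ := hmem
      rw [hagree _ _ (hγ0 r) (hγ r) s hs, hagree _ _ (hγ0 r) (hγ r) t ht]
      exact edist_integralCurve_le hV hL isOpen_Ioo (hγ r) hst fun u hu ↦
        ⟨hs.1.trans_le hu.1, hu.2.trans_lt ht.2⟩
    intro s t
    rcases le_total (s : ℝ) t with h | h
    · exact key s t h
    · rw [edist_comm, edist_comm s t]
      exact key t s h
  have hDt : TotallyBounded (Set.univ : Set D) := by
    rw [← totallyBounded_image_iff (isUniformInducing_val D), Set.image_univ,
      Subtype.range_coe_subtype]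
    refine (totallyBounded_Icc (-B) B).subset ?_
    rintro t ⟨b, hb, -, -, -, ht⟩
    exact ⟨by linarith [ht.1], by linarith [ht.2]⟩
  refine (hDt.image hlip.uniformContinuous).subset ?_
  rintro z ⟨b, hb, η, hη0, hη, t, ht, rfl⟩
  exact ⟨⟨t, b, hb, η, hη0, hη, ht⟩, Set.mem_univ _, hagree b η hη0 hη _ ht⟩

variable [CompleteSpace M]

theorem exists_isMIntegralCurve_of_bounded {V : Π z : M, TangentSpace 𝕀 z} (hV : CMDiff 2 (T% V))
    {L : ℝ≥0} (hL : ∀ z, ‖V z‖ ≤ L) (x : M) :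
    ∃ γ : ℝ → M, γ 0 = x ∧ IsMIntegralCurve γ V := by
  refine exists_isMIntegralCurve_of_uniform_time_along (hV.of_le (by norm_num)) x fun B ↦ ?_
  obtain ⟨ε, hε, h⟩ := exists_uniform_time_of_isCompact hV
    (((totallyBounded_integralCurves hV hL x B).closure.isCompact_of_isClosed
      isClosed_closure).insert x)
  refine ⟨ε, hε, fun a ha γ h0 hγ t ht ↦ h _ ?_⟩
  rcases ht with rfl | ht
  · rw [h0]
    exact Set.mem_insert _ _
  · exact Set.mem_insert_of_mem _ (subset_closure ⟨a, ha, γ, h0, hγ, t, ht, rfl⟩)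

theorem existsUnique_isFlow {V : Π z : M, TangentSpace 𝕀 z} (hV : CMDiff 2 (T% V))
    {L : ℝ≥0} (hL : ∀ z, ‖V z‖ ≤ L) : ∃! X : ℝ → M → M, IsFlow V X := by
  choose γ h0 hγ using exists_isMIntegralCurve_of_bounded hV hL
  refine ⟨fun t x ↦ γ x t, fun x ↦ ⟨h0 x, hγ x⟩, fun X hX ↦ ?_⟩
  funext t x
  exact congrFun (isMIntegralCurve_Ioo_eq_of_contMDiff_boundaryless (t₀ := 0)
    (hV.of_le (by norm_num)) (hX x).2 (hγ x) ((hX x).1.trans (h0 x).symm)) t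

end Complete

set_option maxSynthPendingDepth 3

/-! ### Regularity of the flow -/

section Flow

variable {E : Type*} [NormedAddCommGroup E] [NormedSpace ℝ E] [FiniteDimensional ℝ E]
  [CompleteSpace E]
  {M : Type*} [MetricSpace M] [ChartedSpace E M] [IsManifold 𝓘(ℝ, E) ∞ M]

local notation "𝕀" => 𝓘(ℝ, E)

variable {V : Π z : M, TangentSpace 𝓘(ℝ, E) z} {X : ℝ → M → M}

theorem flow_zero (hX : IsFlow V X) : X 0 = id := funext fun x ↦ (hX x).1

theorem flow_add (hV : CMDiff 2 (T% V)) (hX : IsFlow V X) (r s : ℝ) : X (r + s) = X r ∘ X s := by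
  funext x
  exact congrFun (isMIntegralCurve_Ioo_eq_of_contMDiff_boundaryless (t₀ := 0)
    (hV.of_le (by norm_num)) ((hX x).2.comp_add s) (hX (X s x)).2
    (by simp [(hX (X s x)).1])) r

theorem flow_neg_comp (hV : CMDiff 2 (T% V)) (hX : IsFlow V X) (r : ℝ) : X (-r) ∘ X r = id := by
  rw [← flow_add hV hX, neg_add_cancel, flow_zero hX]

/-- By uniqueness of integral curves, the global flow coincides for short times with the local flow
of the chart. -/
theorem exists_flow_chart (hV : CMDiff 2 (T% V)) (hX : IsFlow V X) (y : M) :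
    ∃ ε : ℝ, 0 < ε ∧ ∃ ψ : ℝ → E → E,
      (∀ᶠ z in nhds y, ∀ r ∈ Set.Ioo (-ε) ε, X r z ∈ (extChartAt 𝕀 y).source ∧
        extChartAt 𝕀 y (X r z) = ψ r (extChartAt 𝕀 y z) ∧
        ContDiffAt ℝ 2 (ψ r) (extChartAt 𝕀 y z)) ∧
      HasDerivAt (fun r ↦ ψ r (extChartAt 𝕀 y y)) (fieldRep y V (extChartAt 𝕀 y y)) 0 ∧
      ψ 0 =ᶠ[nhds (extChartAt 𝕀 y y)] id ∧
      HasDerivAt (fun r ↦ fderiv ℝ (ψ r) (extChartAt 𝕀 y y))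
        (fderiv ℝ (fieldRep y V) (extChartAt 𝕀 y y)) 0 ∧
      ∀ a b, HasDerivAt (fun r ↦ fderiv ℝ (fderiv ℝ (ψ r)) (extChartAt 𝕀 y y) a b)
        (fderiv ℝ (fderiv ℝ (fieldRep y V)) (extChartAt 𝕀 y y) a b) 0 := by
  obtain ⟨ε, hε, ψ, h1, h2, h3, h4⟩ := exists_local_flow_chart hV y
  have h0 : (0 : ℝ) ∈ Set.Ioo (-ε) ε := ⟨neg_lt_zero.2 hε, hε⟩
  refine ⟨ε, hε, ψ, ?_, ?_, h2, h3, h4⟩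
  · filter_upwards [h1] with z hz r hr
    have h := isMIntegralCurveOn_Ioo_eqOn_of_contMDiff_boundaryless h0 (hV.of_le (by norm_num))
      ((hX z).2.isMIntegralCurveOn _) hz.2.2.1 ((hX z).1.trans hz.2.1.symm) hr
    dsimp only at h
    rw [h]
    obtain ⟨hr1, hr2, hr3⟩ := hz.2.2.2 r hr
    exact ⟨(extChartAt 𝕀 y).map_target hr1, (extChartAt 𝕀 y).right_inv hr1, hr3⟩
  · have h := (h1.self_of_nhds.2.2.2 0 h0).2.1
    rwa [h2.self_of_nhds] at h

theorem eventually_contMDiffAt_flow (hV : CMDiff 2 (T% V)) (hX : IsFlow V X) (y : M) :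
    ∃ ε : ℝ, 0 < ε ∧ ∀ᶠ z in nhds y, ∀ r ∈ Set.Ioo (-ε) ε, ContMDiffAt 𝕀 𝕀 2 (X r) z := by
  obtain ⟨ε, hε, ψ, h, -⟩ := exists_flow_chart hV hX y
  refine ⟨ε, hε, ?_⟩
  filter_upwards [h.eventually_nhds, source_mem_nhds (mem_extChartAt_source (I := 𝕀) y)]
    with z hz hzs r hr
  obtain ⟨h1, h2, h3⟩ := hz.self_of_nhds r hr
  have hmem : ψ r (extChartAt 𝕀 y z) ∈ (extChartAt 𝕀 y).target := by
    rw [← h2]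
    exact (extChartAt 𝕀 y).map_source h1
  have h4 : ContMDiffAt 𝕀 𝕀 2 (fun z ↦ (extChartAt 𝕀 y).symm (ψ r (extChartAt 𝕀 y z))) z :=
    (contMDiffAt_chart_symm two_le_infty hmem).comp z
      (h3.contMDiffAt.comp z (contMDiffAt_chart two_le_infty hzs))
  refine h4.congr_of_eventuallyEq ?_
  filter_upwards [hz] with w hw
  rw [← (hw r hr).2.1, (extChartAt 𝕀 y).left_inv (hw r hr).1]

/-- The times at which the flow is `C²` at `x` form an open and closed subset of `ℝ` containing `0`.
-/
theorem contMDiff_flow (hV : CMDiff 2 (T% V)) (hX : IsFlow V X) (t : ℝ) :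
    ContMDiff 𝕀 𝕀 2 (X t) := by
  intro x
  set S : Set ℝ := {t | ContMDiffAt 𝕀 𝕀 2 (X t) x}
  -- Since `X t = X (t - s) ∘ X s`, short-time regularity near `X t₀ x` transfers from any nearby
  -- `s` to any nearby `t`. The symmetry in `s` and `t` gives both openness and closedness.
  have key : ∀ t₀, ∃ δ : ℝ, 0 < δ ∧ ∀ s ∈ Metric.ball t₀ δ, ∀ t ∈ Metric.ball t₀ δ, s ∈ S → t ∈ S := by
    intro t₀
    obtain ⟨ε, hε, h⟩ := eventually_contMDiffAt_flow hV hX (X t₀ x)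
    obtain ⟨δ, hδ, hδ'⟩ := Metric.eventually_nhds_iff_ball.1
      ((hX x).2.continuous.continuousAt.eventually h)
    refine ⟨min δ (ε / 2), lt_min hδ (by positivity), fun s hs t ht hsS ↦ ?_⟩
    have h1 := hδ' s (Metric.ball_subset_ball (min_le_left _ _) hs) (t - s) (by
      have h1 := Metric.ball_subset_ball (min_le_right _ _) hs
      have h2 := Metric.ball_subset_ball (min_le_right _ _) ht
      rw [Real.ball_eq_Ioo] at h1 h2
      exact ⟨by linarith [h1.2, h2.1], by linarith [h1.1, h2.2]⟩)
    have h2 := flow_add hV hX (t - s) s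
    rw [sub_add_cancel] at h2
    change ContMDiffAt 𝕀 𝕀 2 (X t) x
    rw [h2]
    exact h1.comp x hsS
  have hopen : IsOpen S := Metric.isOpen_iff.2 fun t₀ ht₀ ↦ by
    obtain ⟨δ, hδ, h⟩ := key t₀
    exact ⟨δ, hδ, fun t ht ↦ h t₀ (Metric.mem_ball_self hδ) t ht ht₀⟩
  have hclosed : IsClosed S := ⟨Metric.isOpen_iff.2 fun t₀ ht₀ ↦ by
    obtain ⟨δ, hδ, h⟩ := key t₀
    exact ⟨δ, hδ, fun t ht htS ↦ ht₀ (h t ht t₀ (Metric.mem_ball_self hδ) htS)⟩⟩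
  have h0 : (0 : ℝ) ∈ S := by
    change ContMDiffAt 𝕀 𝕀 2 (X 0) x
    rw [flow_zero hX]
    exact contMDiffAt_id
  have : S = Set.univ := IsClopen.eq_univ ⟨hclosed, hopen⟩ ⟨0, h0⟩
  exact this.ge (Set.mem_univ t)

theorem mdifferentiableAt_flow (hV : CMDiff 2 (T% V)) (hX : IsFlow V X) (t : ℝ) (x : M) :
    MDifferentiableAt 𝕀 𝕀 (X t) x :=
  (contMDiff_flow hV hX t x).mdifferentiableAt (by simp)

theorem mfderiv_flow_comp (hV : CMDiff 2 (T% V)) (hX : IsFlow V X) (r s : ℝ) (x : M)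
    (v : TangentSpace 𝕀 x) :
    mfderiv 𝕀 𝕀 (X r ∘ X s) x v = mfderiv 𝕀 𝕀 (X r) (X s x) (mfderiv 𝕀 𝕀 (X s) x v) := by
  rw [mfderiv_comp x (mdifferentiableAt_flow hV hX r _) (mdifferentiableAt_flow hV hX s x)]
  rfl

/-- The derivative of the flow, in a chart in which the flow is represented by `ψ`. -/
theorem chartCoord_mfderiv {Φ : M → M} {ψ : E → E} {y z : M} (hz : z ∈ (extChartAt 𝕀 y).source)
    (hΦz : Φ z ∈ (extChartAt 𝕀 y).source) (hΦ : MDifferentiableAt 𝕀 𝕀 Φ z)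
    (hψ : DifferentiableAt ℝ ψ (extChartAt 𝕀 y z))
    (h : (fun x ↦ extChartAt 𝕀 y (Φ x)) =ᶠ[nhds z] fun x ↦ ψ (extChartAt 𝕀 y x))
    (v : TangentSpace 𝕀 z) :
    chartCoord y (Φ z) (mfderiv 𝕀 𝕀 Φ z v) =
      fderiv ℝ ψ (extChartAt 𝕀 y z) (chartCoord y z v) := by
  have h1 := (mdifferentiableAt_chart (E := E) hΦz).hasMFDerivAt.comp z hΦ.hasMFDerivAt
  have h2 := hψ.hasFDerivAt.hasMFDerivAt.comp z (mdifferentiableAt_chart (E := E) hz).hasMFDerivAt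
  rw [← chartCoord_eq_mfderiv hΦz] at h1
  rw [← chartCoord_eq_mfderiv hz] at h2
  exact DFunLike.congr_fun (hasMFDerivAt_unique h1 (h2.congr_of_eventuallyEq h)) v

end Flow

/-! ### Evolution in a chart -/

theorem fderiv_fderiv_comp_apply {F G H : Type*} [NormedAddCommGroup F] [NormedSpace ℝ F]
    [NormedAddCommGroup G] [NormedSpace ℝ G] [NormedAddCommGroup H] [NormedSpace ℝ H]
    {q : G → H} {ψ : F → G} {p : F} (hq : ContDiffAt ℝ 2 q (ψ p)) (hψ : ContDiffAt ℝ 2 ψ p)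
    (a b : F) :
    fderiv ℝ (fderiv ℝ (q ∘ ψ)) p a b =
      fderiv ℝ (fderiv ℝ q) (ψ p) (fderiv ℝ ψ p a) (fderiv ℝ ψ p b) +
        fderiv ℝ q (ψ p) (fderiv ℝ (fderiv ℝ ψ) p a b) := by
  have h1 : fderiv ℝ (q ∘ ψ) =ᶠ[nhds p] fun x ↦ (fderiv ℝ q (ψ x)).comp (fderiv ℝ ψ x) := by
    filter_upwards [hψ.continuousAt.eventually (hq.eventually (by simp)),
      hψ.eventually (by simp)] with x hx hx'
    exact fderiv_comp x (hx.differentiableAt (by simp)) (hx'.differentiableAt (by simp))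
  have hq1 : HasFDerivAt (fderiv ℝ q) (fderiv ℝ (fderiv ℝ q) (ψ p)) (ψ p) :=
    ((hq.fderiv_right (m := 1) le_rfl).differentiableAt (by simp)).hasFDerivAt
  have hψ1 : HasFDerivAt (fderiv ℝ ψ) (fderiv ℝ (fderiv ℝ ψ) p) p :=
    ((hψ.fderiv_right (m := 1) le_rfl).differentiableAt (by simp)).hasFDerivAt
  have hψ0 : HasFDerivAt ψ (fderiv ℝ ψ p) p := (hψ.differentiableAt (by simp)).hasFDerivAt
  have h2 : HasFDerivAt (fun x ↦ fderiv ℝ q (ψ x)) _ p := hq1.comp p hψ0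
  rw [h1.fderiv_eq, (h2.clm_comp hψ1).fderiv]
  simp
  abel

/-! ### Product rules at time zero for families of linear maps starting at the identity. -/

section Abstract

variable {F : Type*} [NormedAddCommGroup F] [NormedSpace ℝ F]
  {A : ℝ → F →L[ℝ] F} {A' : F →L[ℝ] F} {p : ℝ → F} {p' : F}

theorem hasDerivAt_clm_apply_apply {G : Type*} [NormedAddCommGroup G] [NormedSpace ℝ G]
    {K : ℝ → F →L[ℝ] F →L[ℝ] G} {K' : F →L[ℝ] F →L[ℝ] G} (hK : HasDerivAt K K' 0)
    (hA0 : A 0 = 1) (hA : HasDerivAt A A' 0) (a b : F) :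
    HasDerivAt (fun r ↦ K r (A r a) (A r b)) (K' a b + K 0 (A' a) b + K 0 a (A' b)) 0 := by
  have hAa (a : F) : HasDerivAt (fun r ↦ A r a) (A' a) 0 := by
    simpa using hA.clm_apply (hasDerivAt_const 0 a)
  have h2 := (hK.clm_apply (hAa a)).clm_apply (hAa b)
  simpa [hA0] using h2

theorem hasDerivAt_comp_fderiv {G : Type*} [NormedAddCommGroup G] [NormedSpace ℝ G] {Γ : F → G}
    (hp : HasDerivAt p p' 0) (hΓ : DifferentiableAt ℝ Γ (p 0)) :
    HasDerivAt (fun r ↦ Γ (p r)) (fderiv ℝ Γ (p 0) p') 0 :=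
  hΓ.hasFDerivAt.comp_hasDerivAt 0 hp

/-- Serves twice: with the metric as `Γ` for the norm of transported vectors, and with the
Christoffel symbols for second derivatives. -/
theorem hasDerivAt_bilin {G : Type*} [NormedAddCommGroup G] [NormedSpace ℝ G]
    {Γ : F → F →L[ℝ] F →L[ℝ] G}
    (hA0 : A 0 = 1) (hA : HasDerivAt A A' 0) (hp : HasDerivAt p p' 0)
    (hΓ : DifferentiableAt ℝ Γ (p 0)) (a b : F) :
    HasDerivAt (fun r ↦ Γ (p r) (A r a) (A r b))
      (fderiv ℝ Γ (p 0) p' a b + Γ (p 0) (A' a) b + Γ (p 0) a (A' b)) 0 := by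
  have h1 : HasDerivAt (fun r ↦ Γ (p r)) (fderiv ℝ Γ (p 0) p') 0 := hasDerivAt_comp_fderiv hp hΓ
  generalize fderiv ℝ Γ (p 0) p' = K' at h1 ⊢
  exact hasDerivAt_clm_apply_apply (K := fun r ↦ Γ (p r)) h1 hA0 hA a b

theorem hasDerivAt_ringInverse {R : Type*} [NormedRing R] [NormedAlgebra ℝ R] [CompleteSpace R]
    {A : ℝ → R} {A' : R} (hA0 : A 0 = 1) (hA : HasDerivAt A A' 0) :
    HasDerivAt (fun r ↦ Ring.inverse (A r)) (-A') 0 := by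
  have h1 := hasFDerivAt_ringInverse (𝕜 := ℝ) (1 : Rˣ)
  rw [Units.val_one, ← hA0] at h1
  refine (h1.comp_hasDerivAt (0 : ℝ) hA).congr_deriv ?_
  simp

theorem hasDerivAt_inverse_apply [CompleteSpace F] (hA0 : A 0 = 1) (hA : HasDerivAt A A' 0)
    {W : ℝ → F} {W' : F} (hW : HasDerivAt W W' 0) (l : F →L[ℝ] ℝ) :
    HasDerivAt (fun r ↦ l (Ring.inverse (A r) (W r))) (l (W' - A' (W 0))) 0 := by
  have h := l.hasFDerivAt.comp_hasDerivAt (0 : ℝ) ((hasDerivAt_ringInverse hA0 hA).clm_apply hW)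
  refine h.congr_deriv (congrArg l ?_)
  rw [hA0, Ring.inverse_one]
  simp
  abel

end Abstract

/-! ### Evolution equations along the flow -/

/-- With the group law, this reduces every evolution equation to time zero. -/
theorem hasDerivAt_of_hasDerivAt_add {f : ℝ → ℝ} {D s : ℝ}
    (h : HasDerivAt (fun r ↦ f (r + s)) D 0) : HasDerivAt f D s := by
  rw [← sub_self s] at h
  simpa using h.comp_sub_const s s

section Evolution

variable {E : Type*} [NormedAddCommGroup E] [NormedSpace ℝ E] [FiniteDimensional ℝ E]
  [CompleteSpace E]
  {M : Type*} [MetricSpace M] [ChartedSpace E M] [IsManifold 𝓘(ℝ, E) ∞ M]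
  [RiemannianBundle (fun x : M ↦ TangentSpace 𝓘(ℝ, E) x)]
  [IsContMDiffRiemannianBundle 𝓘(ℝ, E) ∞ E (fun x : M ↦ TangentSpace 𝓘(ℝ, E) x)]

local notation "𝕀" => 𝓘(ℝ, E)

variable {V : Π z : M, TangentSpace 𝓘(ℝ, E) z} {X : ℝ → M → M}

/-- In a chart the derivative contains the derivative of the metric along `V` and the coordinate
derivative of `V`. Metric compatibility turns the former into Christoffel terms, and symmetry of `Γ`
assembles the sum into `∇V`. -/
theorem hasDerivAt_norm_sq_mfderiv_flow_zero (hV : CMDiff 2 (T% V)) (hX : IsFlow V X) (y : M)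
    (a : TangentSpace 𝕀 y) :
    HasDerivAt (fun r ↦ ‖mfderiv 𝕀 𝕀 (X r) y a‖ ^ 2) (2 * inner ℝ (leviCivita 𝕀 M V y a) a) 0 := by
  obtain ⟨ε, hε, ψ, h1, h2, h3, h4, -⟩ := exists_flow_chart hV hX y
  have hy := mem_extChartAt_source (I := 𝕀) y
  have hp := mem_extChartAt_target (I := 𝕀) y
  set p := extChartAt 𝕀 y y with hpdef
  set b := chartCoord y y a
  have hA0 : fderiv ℝ (ψ 0) p = 1 := by rw [h3.fderiv_eq, fderiv_id]; rfl
  have hp0 : ψ 0 p = p := h3.self_of_nhds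
  have hd : DifferentiableAt ℝ (metricRep (M := M) y) p :=
    (contDiffAt_metricRep (n := 1) two_le_infty hp).differentiableAt (by simp)
  have hd' : DifferentiableAt ℝ (metricRep (M := M) y) (ψ 0 p) := by rwa [hp0]
  have key := hasDerivAt_bilin hA0 h4 h2 hd' b b
  rw [hp0, fderiv_metricRep hp] at key
  have hsymm (u v : E) : metricRep (M := M) y p u v = metricRep y p v u := by
    rw [metricRep_apply, metricRep_apply, real_inner_comm]
  have hval : 2 * inner ℝ (leviCivita 𝕀 M V y a) a =
      metricRep y p (christoffel (M := M) y p (fieldRep y V p) b) b +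
      metricRep y p b (christoffel (M := M) y p (fieldRep y V p) b) +
      metricRep y p (fderiv ℝ (fieldRep y V) p b) b +
      metricRep y p b (fderiv ℝ (fieldRep y V) p b) := by
    rw [← metricRep_chart hy, chartCoord_leviCivita hy ((hV y).mdifferentiableAt (by simp)),
      ← fieldRep_chart V hy, christoffel_symm hp, ← hpdef, map_add, add_apply]
    rw [hsymm b, hsymm b]
    ring
  rw [hval]
  refine key.congr_of_eventuallyEq ?_
  filter_upwards [Ioo_mem_nhds (neg_lt_zero.2 hε) hε] with r hr
  obtain ⟨h5, h6, h7⟩ := h1.self_of_nhds r hr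
  rw [← real_inner_self_eq_norm_sq, ← metricRep_chart h5, h6,
    chartCoord_mfderiv hy h5 (mdifferentiableAt_flow hV hX r y) (h7.differentiableAt (by simp))
      (h1.mono fun z hz ↦ (hz r hr).2.1)]

/-- Let `q` represent `φ ∘ X (-r)`, so that `φ` is represented by `q ∘ ψ_r`, and let `A = Dψ_r`. The
chain rule expresses `D²q(Aa, Ab)` and `Dq = Dφ ∘ A⁻¹` through `φ`, and the function becomes `D²φ(a,
b) - Dφ(A⁻¹(D²ψ_r(a, b) + Γ(ψ_r)(Aa, Ab)))`. Only `ψ_r` depends on `r` here, so no third derivative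
of `φ` arises. -/
theorem hasDerivAt_secondDeriv_flow_zero (hV : CMDiff 2 (T% V)) (hX : IsFlow V X) (y : M)
    {φ : M → ℝ} (hφ : ContMDiff 𝕀 𝓘(ℝ, ℝ) 2 φ) (a b : TangentSpace 𝕀 y) :
    HasDerivAt (fun r ↦ secondDeriv (φ ∘ X (-r)) (X r y) (mfderiv 𝕀 𝕀 (X r) y a)
      (mfderiv 𝕀 𝕀 (X r) y b))
      (- mvfderiv 𝕀 φ y (secondCovDeriv V y a b + curvature y (V y) a b)) 0 := by
  obtain ⟨ε, hε, ψ, h1, h2, h3, h4, h5⟩ := exists_flow_chart hV hX y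
  have hy := mem_extChartAt_source (I := 𝕀) y
  have hp := mem_extChartAt_target (I := 𝕀) y
  have hcc := chartCoord_secondCovDeriv_add_curvature (hV y) a b
  rw [mvfderiv_eq_fderiv_funRep hy ((hφ y).mdifferentiableAt (by simp)), hcc]
  clear hcc
  set p := extChartAt 𝕀 y y with hpdef
  set a' := chartCoord y y a
  set b' := chartCoord y y b
  set l := fderiv ℝ (funRep y φ) p
  set f := fieldRep y V
  set Γ : E → E →L[ℝ] E →L[ℝ] E := christoffel (M := M) y
  have hA0 : fderiv ℝ (ψ 0) p = 1 := by rw [h3.fderiv_eq, fderiv_id]; rfl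
  have hp0 : ψ 0 p = p := h3.self_of_nhds
  have hD0 : fderiv ℝ (fderiv ℝ (ψ 0)) p a' b' = 0 := by
    rw [h3.fderiv.fderiv_eq]
    have : fderiv ℝ (id : E → E) = fun _ ↦ ContinuousLinearMap.id ℝ E := by
      ext1 x; exact fderiv_id
    rw [this, fderiv_const_apply]
    rfl
  have hd : DifferentiableAt ℝ Γ (ψ 0 p) := by rw [hp0]; exact differentiableAt_christoffel hp
  have hW := (h5 a' b').add (hasDerivAt_bilin hA0 h4 h2 hd a' b')
  have key := (hasDerivAt_inverse_apply hA0 h4 hW l).const_sub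
    (fderiv ℝ (fderiv ℝ (funRep y φ)) p a' b')
  have hval : -l (fderiv ℝ (fderiv ℝ f) p a' b' + fderiv ℝ Γ p (f p) a' b' +
      Γ p (fderiv ℝ f p a') b' + Γ p a' (fderiv ℝ f p b') - fderiv ℝ f p (Γ p a' b')) =
      -l (fderiv ℝ (fderiv ℝ f) p a' b' + (fderiv ℝ Γ (ψ 0 p) (f p) a' b' +
        Γ (ψ 0 p) (fderiv ℝ f p a') b' + Γ (ψ 0 p) a' (fderiv ℝ f p b')) -
        fderiv ℝ f p (fderiv ℝ (fderiv ℝ (ψ 0)) p a' b' +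
          Γ (ψ 0 p) (fderiv ℝ (ψ 0) p a') (fderiv ℝ (ψ 0) p b'))) := by
    rw [hp0, hD0, hA0]
    simp only [one_apply_eq_self, zero_add, add_assoc]
  rw [hval]
  refine key.congr_of_eventuallyEq ?_
  -- Invertible maps form an open set containing the value at `r = 0`. Where invertibility fails,
  -- `Ring.inverse` is zero and the formula is not claimed.
  have hunit : ∀ᶠ r in nhds (0 : ℝ), IsUnit (fderiv ℝ (ψ r) p) := by
    refine h4.continuousAt.eventually (Units.isOpen.mem_nhds ?_)
    change IsUnit (fderiv ℝ (ψ 0) p)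
    rw [hA0]
    exact isUnit_one
  filter_upwards [Ioo_mem_nhds (neg_lt_zero.2 hε) hε, hunit] with r hr hru
  obtain ⟨h6, h7, h8⟩ := h1.self_of_nhds r hr
  have hχ : ContMDiff 𝕀 𝓘(ℝ, ℝ) 2 (φ ∘ X (-r)) := hφ.comp (contMDiff_flow hV hX (-r))
  have hφχ : funRep y φ =ᶠ[nhds p] funRep y (φ ∘ X (-r)) ∘ ψ r := by
    have hsymm : ContinuousAt (extChartAt 𝕀 y).symm p := continuousAt_extChartAt_symm y
    have h1' : ∀ᶠ z in nhds ((extChartAt 𝕀 y).symm p), ∀ r ∈ Set.Ioo (-ε) ε,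
        X r z ∈ (extChartAt 𝕀 y).source ∧ extChartAt 𝕀 y (X r z) = ψ r (extChartAt 𝕀 y z) ∧
        ContDiffAt ℝ 2 (ψ r) (extChartAt 𝕀 y z) := by
      rwa [hpdef, (extChartAt 𝕀 y).left_inv hy]
    filter_upwards [hsymm.eventually h1', target_mem_nhds hp] with q hq hqt
    obtain ⟨hq1, hq2, -⟩ := hq r hr
    rw [(extChartAt 𝕀 y).right_inv hqt] at hq2
    rw [Function.comp_apply, ← hq2, funRep_chart _ hq1, Function.comp_apply,
      show X (-r) (X r ((extChartAt 𝕀 y).symm q)) = (extChartAt 𝕀 y).symm q from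
        congrFun (flow_neg_comp hV hX r) _]
    rfl
  have hq : ContDiffAt ℝ 2 (funRep y (φ ∘ X (-r))) (ψ r p) := by
    rw [← h7]
    exact (contMDiffAt_iff_funRep two_le_infty h6).1 (hχ _)
  have hchart := chartCoord_mfderiv hy h6 (mdifferentiableAt_flow hV hX r y)
    (h8.differentiableAt (by simp)) (h1.mono fun z hz ↦ (hz r hr).2.1)
  have hl : ∀ u, l u = fderiv ℝ (funRep y (φ ∘ X (-r))) (ψ r p) (fderiv ℝ (ψ r) p u) := fun u ↦ by
    change fderiv ℝ (funRep y φ) p u = _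
    rw [hφχ.fderiv_eq, fderiv_comp p (hq.differentiableAt (by simp))
      (h8.differentiableAt (by simp))]
    rfl
  have hinv : ∀ u, fderiv ℝ (ψ r) p (Ring.inverse (fderiv ℝ (ψ r) p) u) = u := fun u ↦ by
    have := Ring.mul_inverse_cancel _ hru
    exact DFunLike.congr_fun this u
  rw [secondDeriv_eq h6 (hχ _), hchart, hchart, h7, hφχ.fderiv.fderiv_eq,
    fderiv_fderiv_comp_apply hq h8, hl, hinv]
  simp only [Pi.add_apply, map_add]
  change _ = _ + _ - (_ + fderiv ℝ (funRep y (φ ∘ X (-r))) (ψ r p)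
    (Γ (ψ r p) (fderiv ℝ (ψ r) p a') (fderiv ℝ (ψ r) p b')))
  abel

theorem norm_mfderiv_flow_add (hV : CMDiff 2 (T% V)) (hX : IsFlow V X) (r s : ℝ) (x : M)
    (v : TangentSpace 𝕀 x) : ‖mfderiv 𝕀 𝕀 (X (r + s)) x v‖ =
      ‖mfderiv 𝕀 𝕀 (X r) (X s x) (mfderiv 𝕀 𝕀 (X s) x v)‖ := by
  rw [flow_add hV hX, mfderiv_flow_comp hV hX]

theorem secondDeriv_mfderiv_flow_add (hV : CMDiff 2 (T% V)) (hX : IsFlow V X) (g : M → ℝ)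
    (r s : ℝ) (x : M) (v w : TangentSpace 𝕀 x) :
    secondDeriv g (X (r + s) x) (mfderiv 𝕀 𝕀 (X (r + s)) x v) (mfderiv 𝕀 𝕀 (X (r + s)) x w) =
      secondDeriv g (X r (X s x)) (mfderiv 𝕀 𝕀 (X r) (X s x) (mfderiv 𝕀 𝕀 (X s) x v))
        (mfderiv 𝕀 𝕀 (X r) (X s x) (mfderiv 𝕀 𝕀 (X s) x w)) := by
  rw [flow_add hV hX, mfderiv_flow_comp hV hX, mfderiv_flow_comp hV hX]
  rfl

theorem hasDerivAt_norm_sq_mfderiv_flow (hV : CMDiff 2 (T% V)) (hX : IsFlow V X) (x : M)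
    (v : TangentSpace 𝕀 x) (s : ℝ) :
    HasDerivAt (fun s ↦ ‖mfderiv 𝕀 𝕀 (X s) x v‖ ^ 2)
      (2 * inner ℝ (leviCivita 𝕀 M V (X s x) (mfderiv 𝕀 𝕀 (X s) x v))
        (mfderiv 𝕀 𝕀 (X s) x v)) s := by
  have h := hasDerivAt_norm_sq_mfderiv_flow_zero hV hX (X s x) (mfderiv 𝕀 𝕀 (X s) x v)
  simp only [← norm_mfderiv_flow_add hV hX] at h
  exact hasDerivAt_of_hasDerivAt_add h

/-- The second derivative of `g ∘ X (t - s)` along the flow and two vectors transported by it. -/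
def transportedSecondDeriv (X : ℝ → M → M) (g : M → ℝ) (t : ℝ) (x : M) (v w : TangentSpace 𝕀 x)
    (s : ℝ) : ℝ :=
  secondDeriv (g ∘ X (t - s)) (X s x) (mfderiv 𝕀 𝕀 (X s) x v) (mfderiv 𝕀 𝕀 (X s) x w)

theorem hasDerivAt_transportedSecondDeriv (hV : CMDiff 2 (T% V)) (hX : IsFlow V X)
    {g : M → ℝ} (hg : ContMDiff 𝕀 𝓘(ℝ, ℝ) 2 g) (t : ℝ) (x : M) (v w : TangentSpace 𝕀 x) (s : ℝ) :
    HasDerivAt (transportedSecondDeriv X g t x v w)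
      (- mvfderiv 𝕀 (g ∘ X (t - s)) (X s x)
        (secondCovDeriv V (X s x) (mfderiv 𝕀 𝕀 (X s) x v) (mfderiv 𝕀 𝕀 (X s) x w) +
        curvature (X s x) (V (X s x)) (mfderiv 𝕀 𝕀 (X s) x v) (mfderiv 𝕀 𝕀 (X s) x w))) s := by
  have h := hasDerivAt_secondDeriv_flow_zero hV hX (X s x)
    (hg.comp (contMDiff_flow hV hX (t - s))) (mfderiv 𝕀 𝕀 (X s) x v) (mfderiv 𝕀 𝕀 (X s) x w)
  -- Advancing the base point by `r` shortens the remaining time by `r`: the result at time zero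
  -- applies with `φ = g ∘ X (t - s)`.
  have e : ∀ r, (g ∘ X (t - s)) ∘ X (-r) = g ∘ X (t - (r + s)) := fun r ↦ by
    rw [Function.comp_assoc, ← flow_add hV hX]
    congr 2
    ring
  simp only [← secondDeriv_mfderiv_flow_add hV hX, e] at h
  exact hasDerivAt_of_hasDerivAt_add (f := transportedSecondDeriv X g t x v w) h

end Evolution

/-! ### Estimates -/

section Estimates

variable {E : Type*} [NormedAddCommGroup E] [NormedSpace ℝ E] [FiniteDimensional ℝ E]
  [CompleteSpace E]
  {M : Type*} [MetricSpace M] [ChartedSpace E M] [IsManifold 𝓘(ℝ, E) ∞ M]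
  [RiemannianBundle (fun x : M ↦ TangentSpace 𝓘(ℝ, E) x)]
  [IsContMDiffRiemannianBundle 𝓘(ℝ, E) ∞ E (fun x : M ↦ TangentSpace 𝓘(ℝ, E) x)]

local notation "𝕀" => 𝓘(ℝ, E)

variable {V : Π z : M, TangentSpace 𝓘(ℝ, E) z} {X : ℝ → M → M} {g : M → ℝ} {x : M}

/-- Grönwall's argument: `e^{-2Ls} ‖J_s v‖²` is nonincreasing. The squared norm is used because it
is differentiable at the zero vector too. -/
theorem norm_mfderiv_flow_le (hV : IsX2b V) (hX : IsFlow V X) (v : TangentSpace 𝕀 x) {s : ℝ}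
    (hs : 0 ≤ s) :
    ‖mfderiv 𝕀 𝕀 (X s) x v‖ ≤ Real.exp ((normField V).toNNReal * s) * ‖v‖ := by
  set L : ℝ := NNReal.toReal (normField V).toNNReal
  set N : ℝ → ℝ := fun s ↦ ‖mfderiv 𝕀 𝕀 (X s) x v‖ ^ 2 with hN
  have hd (s : ℝ) := ((((hasDerivAt_id s).const_mul (-(2 * L))).exp).mul
    (hasDerivAt_norm_sq_mfderiv_flow hV.1 hX x v s))
  have hanti : Antitone ((fun s ↦ Real.exp (-(2 * L) * id s)) * N) := by
    refine antitone_of_deriv_nonpos (fun s ↦ (hd s).differentiableAt) fun s ↦ ?_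
    rw [(hd s).deriv]
    set J := mfderiv 𝕀 𝕀 (X s) x v
    have h1 : inner ℝ (leviCivita 𝕀 M V (X s x) J) J ≤ L * ‖J‖ ^ 2 := by
      refine (real_inner_le_norm _ _).trans ?_
      have := norm_leviCivita_le hV J
      calc _ ≤ L * ‖J‖ * ‖J‖ := by gcongr
        _ = _ := by ring
    have h2 := Real.exp_pos (-(2 * L) * id s)
    have h3 := mul_le_mul_of_nonneg_left h1 h2.le
    linarith
  have h := hanti hs
  have hN0 : N 0 = ‖v‖ ^ 2 := by
    rw [hN]
    dsimp only
    rw [flow_zero hX, mfderiv_id]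
    rfl
  simp only [Pi.mul_apply, id, mul_zero, Real.exp_zero, one_mul, hN0] at h
  refine le_of_sq_le_sq ?_ (by positivity)
  have h2 : Real.exp (L * s) ^ 2 * Real.exp (-(2 * L) * s) = 1 := by
    rw [← Real.exp_nat_mul, ← Real.exp_add]
    simp
    ring
  calc N s = Real.exp (L * s) ^ 2 * (Real.exp (-(2 * L) * s) * N s) := by
        rw [← mul_assoc, h2, one_mul]
    _ ≤ Real.exp (L * s) ^ 2 * ‖v‖ ^ 2 := by gcongr
    _ = _ := by ring

theorem abs_mvfderiv_comp_flow_le (hV : IsX2b V) (hX : IsFlow V X) (hg : IsC2b 𝕀 g)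
    (v : TangentSpace 𝕀 x) {s : ℝ} (hs : 0 ≤ s) :
    |mvfderiv 𝕀 (g ∘ X s) x v| ≤
      (normFun 𝕀 g).toNNReal * (Real.exp ((normField V).toNNReal * s) * ‖v‖) := by
  have h : mvfderiv 𝕀 (g ∘ X s) x v = mvfderiv 𝕀 g (X s x) (mfderiv 𝕀 𝕀 (X s) x v) := by
    rw [mvfderiv, mfderiv_comp x ((hg.1 _).mdifferentiableAt (by simp))
      (mdifferentiableAt_flow hV.1 hX s x)]
    rfl
  rw [h]
  refine (abs_mvfderiv_le hg _).trans ?_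
  gcongr
  exact norm_mfderiv_flow_le hV hX v hs

/-- A bound for the `C²_b`-norm of `g ∘ X t`, `0 ≤ t ≤ T`, in terms of the norms `A` of `g` and
`L` of the vector field and the bound `K` of the curvature. -/
def flowBound (T : ℝ) (A L K : ℝ≥0) : ℝ :=
  A * Real.exp (L * T) * (1 + Real.exp (L * T) +
    T * ((L + K * L) * (Real.exp (L * T) * Real.exp (L * T))))

/-- The mean value inequality for `transportedSecondDeriv` between times `0` and `t`. In the bound
`B` for its derivative, the outer `e` comes from the gradient of `g ∘ X (t - s)`, the other two from
the transported vectors, and `K * L` from the curvature with `V` as first argument. -/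
theorem abs_secondDeriv_comp_flow_le (hV : IsX2b V) (hR : curvatureSup 𝕀 M < ⊤)
    (hX : IsFlow V X) (hg : IsC2b 𝕀 g) {t T : ℝ} (ht : 0 ≤ t) (htT : t ≤ T)
    (v w : TangentSpace 𝕀 x) :
    |secondDeriv (g ∘ X t) x v w| ≤ flowBound T (normFun 𝕀 g).toNNReal (normField V).toNNReal
      (curvatureSup 𝕀 M).toNNReal * ‖v‖ * ‖w‖ := by
  set A := (normFun 𝕀 g).toNNReal with hA
  set L := (normField V).toNNReal with hL
  set K := (curvatureSup 𝕀 M).toNNReal with hK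
  set e := Real.exp (L * T) with he
  have he0 : 0 < e := Real.exp_pos _
  have hexp {s : ℝ} (hs : s ≤ T) : Real.exp (L * s) ≤ e :=
    Real.exp_le_exp.2 (by gcongr)
  have hJ {s : ℝ} (hs : 0 ≤ s) (hsT : s ≤ T) (v : TangentSpace 𝕀 x) :
      ‖mfderiv 𝕀 𝕀 (X s) x v‖ ≤ e * ‖v‖ :=
    (norm_mfderiv_flow_le hV hX v hs).trans (by gcongr; exact hexp hsT)
  have hT : 0 ≤ T := ht.trans htT
  set h := transportedSecondDeriv X g t x v w
  set B : ℝ := A * (e * ((L + K * L) * (e * ‖v‖) * (e * ‖w‖)))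
  have h0 : h 0 = secondDeriv (g ∘ X t) x v w := by
    change secondDeriv (g ∘ X (t - 0)) (X 0 x) (mfderiv 𝕀 𝕀 (X 0) x v) (mfderiv 𝕀 𝕀 (X 0) x w) = _
    rw [flow_zero hX, mfderiv_id, sub_zero]
    rfl
  have h1 : h t = secondDeriv g (X t x) (mfderiv 𝕀 𝕀 (X t) x v) (mfderiv 𝕀 𝕀 (X t) x w) := by
    change secondDeriv (g ∘ X (t - t)) _ _ _ = _
    rw [sub_self, flow_zero hX]
    rfl
  have hbound : ∀ s ∈ Set.Ico 0 t, ‖- mvfderiv 𝕀 (g ∘ X (t - s)) (X s x)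
        (secondCovDeriv V (X s x) (mfderiv 𝕀 𝕀 (X s) x v) (mfderiv 𝕀 𝕀 (X s) x w) +
        curvature (X s x) (V (X s x)) (mfderiv 𝕀 𝕀 (X s) x v) (mfderiv 𝕀 𝕀 (X s) x w))‖ ≤ B := by
    intro s hs
    set v' := mfderiv 𝕀 𝕀 (X s) x v
    set w' := mfderiv 𝕀 𝕀 (X s) x w
    have hv' : ‖v'‖ ≤ e * ‖v‖ := hJ hs.1 (by linarith [hs.2]) v
    have hw' : ‖w'‖ ≤ e * ‖w‖ := hJ hs.1 (by linarith [hs.2]) w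
    rw [norm_neg, Real.norm_eq_abs]
    refine (abs_mvfderiv_comp_flow_le hV hX hg _ (sub_nonneg.2 hs.2.le)).trans ?_
    have h2 : ‖secondCovDeriv V (X s x) v' w' + curvature (X s x) (V (X s x)) v' w'‖ ≤
        (L + K * L) * (e * ‖v‖) * (e * ‖w‖) := by
      calc _ ≤ L * ‖v'‖ * ‖w'‖ + K * ‖V (X s x)‖ * ‖v'‖ * ‖w'‖ :=
            (norm_add_le _ _).trans (add_le_add (norm_secondCovDeriv_le hV _ _)
              (norm_curvature_le hR _ _ _))
        _ ≤ L * ‖v'‖ * ‖w'‖ + K * L * ‖v'‖ * ‖w'‖ := by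
            gcongr
            exact norm_le_normField hV _
        _ = (L + K * L) * ‖v'‖ * ‖w'‖ := by ring
        _ ≤ _ := by gcongr
    have h3 := hexp (s := t - s) (by linarith [hs.1])
    change A * (Real.exp (L * (t - s)) * _) ≤ A * (e * _)
    gcongr
  have hmean := norm_image_sub_le_of_norm_deriv_le_segment' (f := h) (a := 0) (b := t)
    (fun s _ ↦ (hasDerivAt_transportedSecondDeriv hV.1 hX hg.1 t x v w s).hasDerivWithinAt)
    hbound t (Set.right_mem_Icc.2 ht)
  have hend : |h t| ≤ A * (e * ‖v‖) * (e * ‖w‖) := by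
    rw [h1]
    refine (abs_secondDeriv_le hg _ _).trans ?_
    have h2 := hJ ht htT v
    have h3 := hJ ht htT w
    gcongr
  have hB : 0 ≤ B := by positivity
  have hfin : |h 0| ≤ |h t| + T * B := by
    have h2 := abs_sub_abs_le_abs_sub (h 0) (h t)
    rw [abs_sub_comm, ← Real.norm_eq_abs (h t - h 0)] at h2
    nlinarith
  rw [← h0]
  refine hfin.trans ?_
  have h4 : (0 : ℝ) ≤ A * e * ‖v‖ * ‖w‖ := by positivity
  -- The first term on the right is slack: it comes from the summand `1` in `flowBound`, which makes
  -- the same constant dominate the bounds for the value and the gradient.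
  have h5 : flowBound T A L K * ‖v‖ * ‖w‖ =
      A * e * ‖v‖ * ‖w‖ + A * (e * ‖v‖) * (e * ‖w‖) + T * B := by
    simp only [flowBound, B]
    rw [← he]
    ring
  rw [h5]
  linarith

theorem isC2b_comp_flow (hV : IsX2b V) (hR : curvatureSup 𝕀 M < ⊤) (hX : IsFlow V X)
    (hg : IsC2b 𝕀 g) {t T : ℝ} (ht : 0 ≤ t) (htT : t ≤ T) :
    IsC2b 𝕀 (fun x ↦ g (X t x)) ∧ normFun 𝕀 (fun x ↦ g (X t x)) ≤
      (flowBound T (normFun 𝕀 g).toNNReal (normField V).toNNReal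
        (curvatureSup 𝕀 M).toNNReal).toNNReal := by
  have hT : 0 ≤ T := ht.trans htT
  have key : normFun 𝕀 (g ∘ X t) ≤ (flowBound T (normFun 𝕀 g).toNNReal (normField V).toNNReal
        (curvatureSup 𝕀 M).toNNReal).toNNReal := by
    set A := (normFun 𝕀 g).toNNReal with hA
    set L := (normField V).toNNReal with hL
    set K := (curvatureSup 𝕀 M).toNNReal with hK
    have he : 1 ≤ Real.exp (L * T) := Real.one_le_exp (by positivity)
    have h1 : (A : ℝ) * Real.exp (L * T) ≤ flowBound T A L K := by
      unfold flowBound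
      refine le_mul_of_one_le_right (by positivity) ?_
      rw [add_assoc]
      exact le_add_of_nonneg_right (by positivity)
    have h2 : (A : ℝ) ≤ flowBound T A L K :=
      (le_mul_of_one_le_right A.2 he).trans h1
    have h3 := Real.le_coe_toNNReal (flowBound T A L K)
    refine normFun_le (fun x ↦ ((abs_le_normFun hg _).trans h2).trans h3) (fun x v ↦ ?_)
      fun x v w ↦ ?_
    · refine (abs_mvfderiv_comp_flow_le hV hX hg v ht).trans ?_
      rw [← mul_assoc]
      refine mul_le_mul_of_nonneg_right (le_trans ?_ (h1.trans h3)) (norm_nonneg v)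
      gcongr
    · refine (abs_secondDeriv_comp_flow_le hV hR hX hg ht htT v w).trans ?_
      gcongr
  exact ⟨⟨hg.1.comp (contMDiff_flow hV.1 hX t), key.trans_lt ENNReal.coe_lt_top⟩, key⟩

end Estimates

end RiemannianFlow

end

theorem proposition3p4 (T : ℝ) (hT : 0 ≤ T) :
    ∃ C : ℝ≥0 → ℝ≥0 → ℝ≥0 → ℝ≥0,
      ∀ (d : ℕ) (M : Type*) [MetricSpace M] [ChartedSpace (EuclideanSpace ℝ (Fin d)) M]
        [IsManifold (𝓡 d) ∞ M]
        [RiemannianBundle (fun x : M ↦ TangentSpace (𝓡 d) x)]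
        [IsContMDiffRiemannianBundle (𝓡 d) ∞ (EuclideanSpace ℝ (Fin d))
          (fun x : M ↦ TangentSpace (𝓡 d) x)]
        [IsRiemannianManifold (𝓡 d) M] [ConnectedSpace M] [CompleteSpace M]
        (V : Π x : M, TangentSpace (𝓡 d) x),
        RiemannianFlow.IsX2b V → RiemannianFlow.curvatureSup (𝓡 d) M < ⊤ →
        (∃! X : ℝ → M → M, RiemannianFlow.IsFlow V X) ∧
        ∀ X : ℝ → M → M, RiemannianFlow.IsFlow V X →
          ∀ g : M → ℝ, RiemannianFlow.IsC2b (𝓡 d) g → ∀ t ∈ Set.Icc 0 T,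
            RiemannianFlow.IsC2b (𝓡 d) (fun x ↦ g (X t x)) ∧
            RiemannianFlow.normFun (𝓡 d) (fun x ↦ g (X t x)) ≤
              C (RiemannianFlow.normFun (𝓡 d) g).toNNReal
                (RiemannianFlow.normField V).toNNReal
                (RiemannianFlow.curvatureSup (𝓡 d) M).toNNReal := by
  -- The bound sees the manifold only through `A`, `L` and `K`, so it can be fixed before `d` and
  -- `M`.
  refine ⟨fun A L K ↦ (RiemannianFlow.flowBound T A L K).toNNReal, ?_⟩
  intro d M _ _ _ _ _ _ _ _ V hV hR
  exact ⟨RiemannianFlow.existsUnique_isFlow hV.1 (RiemannianFlow.norm_le_normField hV),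
    fun X hX g hg t ht ↦ RiemannianFlow.isC2b_comp_flow hV hR hX hg ht.1 ht.2⟩
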